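/- Let $R$ be an associative unital ring that is semi-local, i.e. $R/\mathrm{Jac}(R)$ is a finite product of matrix rings over division rings. Let $n \geq 3$ and let $e_1, \ldots, e_n \in R$ be a complete family of orthogonal idempotents ($e_i e_j = 0$ for $i \neq j$, $e_i^2 = e_i$, $\sum_i e_i = 1$) which are pairwise Morita equivalent, i.e. $e_i \in R e_j R$ for all $i, j$. Put $R_{ij} = e_i R e_j$, let $\mathrm{GL}(R) = R^*$ be the group of invertible elements of $R$, and for $i \neq j$, $a \in R_{ij}$ put $t_{ij}(a) = 1 + a \in \mathrm{GL}(R)$. The Steinberg group $\mathrm{St}(R)$ is the group generated by symbols $x_{ij}(a)$ for distinct $i, j \in \{1, \ldots, n\}$ and $a \in R_{ij}$, with the relations $x_{ij}(a)\, x_{ij}(b) = x_{ij}(a + b)$; $[x_{ij}(a), x_{kl}(b)] = 1$ for $j \neq k$ and $i \neq l$; $[x_{ij}(a), x_{jk}(b)] = x_{ik}(ab)$ for $i \neq k$, where $[x, y] = x y x^{-1} y^{-1}$. Let $\mathrm{st} \colon \mathrm{St}(R) \to \mathrm{GL}(R)$ be the homomorphism $x_{ij}(a) \mapsto t_{ij}(a)$.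 The diagonal group $D(R) = \{g \in \mathrm{GL}(R) \mid e_i g e_j = 0 \text{ for } i \neq j\}$ acts on $\mathrm{St}(R)$ by automorphisms via ${}^{g} x_{ij}(a) = x_{ij}(g a g^{-1})$; let $\mathrm{St}(R) \rtimes D(R)$ be the corresponding semidirect product. It maps to $\mathrm{GL}(R)$ by $(x, g) \mapsto \mathrm{st}(x)\, g$ and acts on $\mathrm{St}(R)$ by $(x, g) \cdot y = x\, ({}^{g} y)\, x^{-1}$. Then there is a unique action of $\mathrm{GL}(R)$ on $\mathrm{St}(R)$ by group automorphisms making $\mathrm{st}$ a crossed module, that is, such that $\mathrm{st}({}^{g} y) = g\, \mathrm{st}(y)\, g^{-1}$ and ${}^{\mathrm{st}(x)} y = x y x^{-1}$ for all $g \in \mathrm{GL}(R)$ and $x, y \in \mathrm{St}(R)$. Moreover, this action is consistent with the action of $\mathrm{St}(R) \rtimes D(R)$: the action of $\mathrm{St}(R) \rtimes D(R)$ on $\mathrm{St}(R)$ is the composition of $\mathrm{St}(R) \rtimes D(R) \to \mathrm{GL}(R)$ with the action of $\mathrm{GL}(R)$. -/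

import Mathlib

namespace IsotropicGL

open scoped commutatorElement

universe u

/-- A homomorphism `d : H → G` with an action `φ` of `G` on `H` by automorphisms is a precrossed
module if `d (ᵍh) = g * d h * g⁻¹`. -/
structure IsPrecrossedModule {H G : Type*} [Group H] [Group G]
    (d : H →* G) (φ : G →* MulAut H) : Prop where
  equivariant : ∀ (g : G) (h : H), d (φ g h) = g * d h * g⁻¹

/-- A crossed module is a precrossed module in which `d h` acts on `H` as conjugation by `h`. -/
structure IsCrossedModule {H G : Type*} [Group H] [Group G]
    (d : H →* G) (φ : G →* MulAut H) : Prop extends IsPrecrossedModule d φ where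
  peiffer : ∀ h h' : H, φ (d h) h' = h * h' * h⁻¹

/-- A unital ring is semi-local if its quotient by the Jacobson radical is semi-simple. -/
def IsSemiLocalRing (R : Type u) [Ring R] : Prop :=
  IsSemisimpleRing (R ⧸ Ring.jacobson R)

/-- Semi-simplicity in terms of finite products of matrix rings over division rings. -/
theorem isSemiLocalRing_iff (R : Type u) [Ring R] :
    IsSemiLocalRing R ↔
      ∃ (m : ℕ) (D : Fin m → Type u) (d : Fin m → ℕ) (_ : ∀ i, DivisionRing (D i)),
        Nonempty ((R ⧸ Ring.jacobson R) ≃+* ∀ i, Matrix (Fin (d i)) (Fin (d i)) (D i)) :=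
  isSemisimpleRing_iff_pi_matrix_divisionRing

section

variable {R : Type u} [Ring R]

/-- `a` Morita dominates `b` if `b` lies in the additive subgroup `R a R` (the two-sided ideal
generated by `a`). -/
def MoritaDominates (a b : R) : Prop :=
  b ∈ AddSubgroup.closure {x : R | ∃ r s : R, x = r * a * s}

/-- Two idempotents are Morita equivalent if they Morita dominate each other. -/
def MoritaEquivalent (a b : R) : Prop :=
  MoritaDominates a b ∧ MoritaDominates b a

variable {n : ℕ}

/-- The Peirce component `R_ij = e_i R e_j`. -/
def peirce (e : Fin n → R) (i j : Fin n) : AddSubgroup R where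
  carrier := {x | ∃ r : R, x = e i * r * e j}
  zero_mem' := ⟨0, by simp⟩
  add_mem' := by
    rintro _ _ ⟨r, rfl⟩ ⟨s, rfl⟩
    exact ⟨r + s, by rw [mul_add, add_mul]⟩
  neg_mem' := by
    rintro _ ⟨r, rfl⟩
    exact ⟨-r, by rw [mul_neg, neg_mul]⟩

/-- The multiplication `R_ij × R_jk → R_ik`. -/
def peirceMul {e : Fin n → R} {i j k : Fin n} (a : peirce e i j) (b : peirce e j k) :
    peirce e i k :=
  ⟨(a : R) * (b : R), by
    obtain ⟨_, r, rfl⟩ := a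
    obtain ⟨_, s, rfl⟩ := b
    exact ⟨r * e j * (e j * s), by simp only [mul_assoc]⟩⟩

theorem peirce_mul_zero {e : Fin n → R} (he : OrthogonalIdempotents e) {i j k l : Fin n}
    (hjk : j ≠ k) (a : peirce e i j) (b : peirce e k l) : (a : R) * (b : R) = 0 := by
  obtain ⟨_, r, rfl⟩ := a
  obtain ⟨_, s, rfl⟩ := b
  have h : e j * e k = 0 := he.ortho hjk
  calc e i * r * e j * (e k * s * e l) = e i * r * (e j * e k) * s * e l := by
        simp only [mul_assoc]
    _ = 0 := by rw [h]; simp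

/-- The symbols `x_ij(a)` with `i ≠ j` and `a ∈ R_ij`. -/
structure SteinbergGen (e : Fin n → R) where
  row : Fin n
  col : Fin n
  ne : row ≠ col
  val : peirce e row col

/-- The symbol `x_ij(a)` as an element of the free group. -/
def freeX (e : Fin n → R) {i j : Fin n} (hij : i ≠ j) (a : peirce e i j) :
    FreeGroup (SteinbergGen e) :=
  FreeGroup.of ⟨i, j, hij, a⟩

/-- The Steinberg relators; here `⁅x, y⁆ = x * y * x⁻¹ * y⁻¹`. -/
inductive SteinbergRel (e : Fin n → R) : FreeGroup (SteinbergGen e) → Prop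
  | add {i j : Fin n} (hij : i ≠ j) (a b : peirce e i j) :
      SteinbergRel e (freeX e hij a * freeX e hij b * (freeX e hij (a + b))⁻¹)
  | comm {i j k l : Fin n} (hij : i ≠ j) (hkl : k ≠ l) (hjk : j ≠ k) (hil : i ≠ l)
      (a : peirce e i j) (b : peirce e k l) :
      SteinbergRel e ⁅freeX e hij a, freeX e hkl b⁆
  | mul {i j k : Fin n} (hij : i ≠ j) (hjk : j ≠ k) (hik : i ≠ k)
      (a : peirce e i j) (b : peirce e j k) :
      SteinbergRel e (⁅freeX e hij a, freeX e hjk b⁆ * (freeX e hik (peirceMul a b))⁻¹)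

/-- The Steinberg group `St(R)` of the family `e`. -/
abbrev Steinberg (e : Fin n → R) : Type u :=
  PresentedGroup {w : FreeGroup (SteinbergGen e) | SteinbergRel e w}

/-- The generator `x_ij(a)` of the Steinberg group. -/
def steinbergX (e : Fin n → R) {i j : Fin n} (hij : i ≠ j) (a : peirce e i j) : Steinberg e :=
  PresentedGroup.of ⟨i, j, hij, a⟩

/-- The universal property of the Steinberg group. -/
def steinbergLift {G : Type*} [Group G] {e : Fin n → R}
    (f : ∀ {i j : Fin n}, i ≠ j → peirce e i j → G)
    (hadd : ∀ {i j : Fin n} (hij : i ≠ j) (a b : peirce e i j),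
      f hij a * f hij b = f hij (a + b))
    (hcomm : ∀ {i j k l : Fin n} (hij : i ≠ j) (hkl : k ≠ l), j ≠ k → i ≠ l →
      ∀ (a : peirce e i j) (b : peirce e k l), ⁅f hij a, f hkl b⁆ = 1)
    (hmul : ∀ {i j k : Fin n} (hij : i ≠ j) (hjk : j ≠ k) (hik : i ≠ k)
      (a : peirce e i j) (b : peirce e j k), ⁅f hij a, f hjk b⁆ = f hik (peirceMul a b)) :
    Steinberg e →* G :=
  PresentedGroup.toGroup (f := fun g : SteinbergGen e => f g.ne g.val) (by
    intro w hw
    induction hw with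
    | add hij a b => simp [freeX, hadd]
    | comm hij hkl hjk hil a b => simp [freeX, map_commutatorElement, hcomm hij hkl hjk hil]
    | mul hij hjk hik a b =>
      simp [freeX, map_commutatorElement, hmul hij hjk hik])

theorem steinbergLift_x {G : Type*} [Group G] {e : Fin n → R}
    (f : ∀ {i j : Fin n}, i ≠ j → peirce e i j → G) (hadd hcomm hmul)
    {i j : Fin n} (hij : i ≠ j) (a : peirce e i j) :
    steinbergLift f hadd hcomm hmul (steinbergX e hij a) = f hij a :=
  PresentedGroup.toGroup.of _

theorem steinberg_hom_ext {G : Type*} [Group G] {e : Fin n → R} {f g : Steinberg e →* G}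
    (h : ∀ {i j : Fin n} (hij : i ≠ j) (a : peirce e i j),
      f (steinbergX e hij a) = g (steinbergX e hij a)) : f = g :=
  PresentedGroup.ext fun x => h x.ne x.val

theorem steinbergX_add {e : Fin n → R} {i j : Fin n} (hij : i ≠ j) (a b : peirce e i j) :
    steinbergX e hij a * steinbergX e hij b = steinbergX e hij (a + b) :=
  PresentedGroup.mk_eq_mk_of_mul_inv_mem (SteinbergRel.add hij a b)

theorem steinbergX_comm {e : Fin n → R} {i j k l : Fin n} (hij : i ≠ j) (hkl : k ≠ l)
    (hjk : j ≠ k) (hil : i ≠ l) (a : peirce e i j) (b : peirce e k l) :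
    ⁅steinbergX e hij a, steinbergX e hkl b⁆ = 1 :=
  PresentedGroup.one_of_mem (SteinbergRel.comm hij hkl hjk hil a b)

theorem steinbergX_mul {e : Fin n → R} {i j k : Fin n} (hij : i ≠ j) (hjk : j ≠ k)
    (hik : i ≠ k) (a : peirce e i j) (b : peirce e j k) :
    ⁅steinbergX e hij a, steinbergX e hjk b⁆ = steinbergX e hik (peirceMul a b) :=
  PresentedGroup.mk_eq_mk_of_mul_inv_mem (SteinbergRel.mul hij hjk hik a b)

/-- The elementary transvection `t_ij(a) = 1 + a` in `GL(R) = Rˣ`. -/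
def transvection {e : Fin n → R} (he : OrthogonalIdempotents e) {i j : Fin n} (hij : i ≠ j)
    (a : peirce e i j) : Rˣ where
  val := 1 + a
  inv := 1 - a
  val_inv := by
    have h := peirce_mul_zero he hij.symm a a
    simp [mul_sub, add_mul, h]
  inv_val := by
    have h := peirce_mul_zero he hij.symm a a
    simp [mul_add, sub_mul, h]

/-- The homomorphism `st : St(R) → GL(R)`, `x_ij(a) ↦ t_ij(a)`. -/
def st {e : Fin n → R} (he : OrthogonalIdempotents e) : Steinberg e →* Rˣ :=
  steinbergLift (fun hij a => transvection he hij a)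
    (by
      intro i j hij a b
      ext
      have h := peirce_mul_zero he hij.symm a b
      simp [transvection, mul_add, add_mul, h, add_assoc])
    (by
      intro i j k l hij hkl hjk hil a b
      rw [commutatorElement_eq_one_iff_mul_comm]
      ext
      have h := peirce_mul_zero he hjk a b
      have h' := peirce_mul_zero he hil.symm b a
      simp only [transvection, Units.val_mul, mul_add, add_mul, h, h', mul_one, one_mul, add_zero]
      abel)
    (by
      intro i j k hij hjk hik a b
      rw [commutatorElement_def, mul_inv_eq_iff_eq_mul, mul_inv_eq_iff_eq_mul]
      ext
      have h₁ := peirce_mul_zero he hjk.symm (peirceMul a b) b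
      have h₂ := peirce_mul_zero he hik.symm b a
      have h₃ := peirce_mul_zero he hik.symm (peirceMul a b) a
      have hab : ((peirceMul a b : peirce e i k) : R) = (a : R) * (b : R) := rfl
      simp only [hab] at h₁ h₃
      simp only [transvection, Units.val_mul, hab, mul_add, add_mul, h₁, h₂, h₃, mul_one, one_mul,
        add_zero]
      abel)

theorem st_x {e : Fin n → R} (he : OrthogonalIdempotents e) {i j : Fin n} (hij : i ≠ j)
    (a : peirce e i j) : st he (steinbergX e hij a) = transvection he hij a :=
  steinbergLift_x _ _ _ _ hij a

theorem diag_commute {e : Fin n → R} (he : CompleteOrthogonalIdempotents e) {g : R}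
    (hg : ∀ i j : Fin n, i ≠ j → e i * g * e j = 0) (i : Fin n) : e i * g = g * e i := by
  have h₁ : e i * g = e i * g * e i := by
    calc e i * g = e i * g * ∑ j, e j := by rw [he.complete, mul_one]
      _ = ∑ j, e i * g * e j := Finset.mul_sum _ _ _
      _ = e i * g * e i :=
        Finset.sum_eq_single i (fun j _ hj => hg i j hj.symm) (by simp)
  have h₂ : g * e i = e i * g * e i := by
    calc g * e i = (∑ j, e j) * (g * e i) := by rw [he.complete, one_mul]
      _ = ∑ j, e j * (g * e i) := Finset.sum_mul _ _ _
      _ = e i * (g * e i) :=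
        Finset.sum_eq_single i (fun j _ hj => by rw [← mul_assoc]; exact hg j i hj) (by simp)
      _ = e i * g * e i := (mul_assoc _ _ _).symm
  rw [h₁, h₂]

/-- The diagonal group `D(R) = {g ∈ GL(R) | e_i g e_j = 0 for i ≠ j}`. -/
def diagGroup {e : Fin n → R} (he : CompleteOrthogonalIdempotents e) : Subgroup Rˣ where
  carrier := {g | ∀ i j : Fin n, i ≠ j → e i * (g : R) * e j = 0}
  one_mem' := by
    intro i j hij
    simpa using! he.ortho hij
  mul_mem' := by
    intro g h hg hh i j hij
    rw [Units.val_mul, ← mul_assoc, diag_commute he hg, mul_assoc, mul_assoc, ← mul_assoc (e i),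
      hh i j hij, mul_zero]
  inv_mem' := by
    intro g hg i j hij
    have h : e i * (↑g⁻¹ : R) = (↑g⁻¹ : R) * e i := by
      rw [Units.mul_inv_eq_iff_eq_mul, mul_assoc, diag_commute he hg, Units.inv_mul_cancel_left]
    rw [h, mul_assoc]
    have h' : e i * e j = 0 := he.ortho hij
    rw [h', mul_zero]

/-- For `g ∈ D(R)` and `a ∈ R_ij`, the element `g a g⁻¹` of `R_ij`. -/
def diagConj {e : Fin n → R} (he : CompleteOrthogonalIdempotents e) (g : diagGroup he)
    {i j : Fin n} (a : peirce e i j) : peirce e i j :=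
  ⟨((g : Rˣ) : R) * (a : R) * (((g⁻¹ : diagGroup he) : Rˣ) : R), by
    obtain ⟨_, r, rfl⟩ := a
    refine ⟨((g : Rˣ) : R) * r * (((g⁻¹ : diagGroup he) : Rˣ) : R), ?_⟩
    have h₁ := diag_commute he g.2 i
    have h₂ := diag_commute he (g⁻¹).2 j
    calc ((g : Rˣ) : R) * (e i * r * e j) * (((g⁻¹ : diagGroup he) : Rˣ) : R)
        = (((g : Rˣ) : R) * e i) * r * (e j * (((g⁻¹ : diagGroup he) : Rˣ) : R)) := by
          simp only [mul_assoc]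
      _ = _ := by rw [← h₁, h₂]; simp only [mul_assoc]⟩

/-- The endomorphism `x_ij(a) ↦ x_ij(g a g⁻¹)` of the Steinberg group, for `g ∈ D(R)`. -/
def diagEnd {e : Fin n → R} (he : CompleteOrthogonalIdempotents e) (g : diagGroup he) :
    Steinberg e →* Steinberg e :=
  steinbergLift (fun hij a => steinbergX e hij (diagConj he g a))
    (by
      intro i j hij a b
      rw [steinbergX_add]
      congr 1
      ext
      simp [diagConj, mul_add, add_mul])
    (by
      intro i j k l hij hkl hjk hil a b
      exact steinbergX_comm hij hkl hjk hil _ _)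
    (by
      intro i j k hij hjk hik a b
      rw [steinbergX_mul hij hjk hik]
      congr 1
      ext
      simp [diagConj, peirceMul, mul_assoc])

theorem diagEnd_x {e : Fin n → R} (he : CompleteOrthogonalIdempotents e) (g : diagGroup he)
    {i j : Fin n} (hij : i ≠ j) (a : peirce e i j) :
    diagEnd he g (steinbergX e hij a) = steinbergX e hij (diagConj he g a) :=
  steinbergLift_x _ _ _ _ hij a

theorem diagEnd_mul {e : Fin n → R} (he : CompleteOrthogonalIdempotents e)
    (g h : diagGroup he) : diagEnd he (g * h) = (diagEnd he g).comp (diagEnd he h) := by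
  refine steinberg_hom_ext fun hij a => ?_
  rw [MonoidHom.comp_apply, diagEnd_x, diagEnd_x, diagEnd_x]
  congr 1
  ext
  simp [diagConj, mul_assoc]

theorem diagEnd_one {e : Fin n → R} (he : CompleteOrthogonalIdempotents e) :
    diagEnd he 1 = MonoidHom.id _ := by
  refine steinberg_hom_ext fun hij a => ?_
  rw [MonoidHom.id_apply, diagEnd_x]
  congr 1
  ext
  simp [diagConj]

/-- The action of `D(R)` on `St(R)` by automorphisms, `ᵍx_ij(a) = x_ij(g a g⁻¹)`. -/
def diagAct {e : Fin n → R} (he : CompleteOrthogonalIdempotents e) :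
    diagGroup he →* MulAut (Steinberg e) where
  toFun g := MonoidHom.toMulEquiv (diagEnd he g) (diagEnd he g⁻¹)
    (by rw [← diagEnd_mul, inv_mul_cancel, diagEnd_one])
    (by rw [← diagEnd_mul, mul_inv_cancel, diagEnd_one])
  map_one' := by
    ext x
    exact DFunLike.congr_fun (diagEnd_one he) x
  map_mul' g h := by
    ext x
    exact DFunLike.congr_fun (diagEnd_mul he g h) x

theorem diagAct_x {e : Fin n → R} (he : CompleteOrthogonalIdempotents e) (g : diagGroup he)
    {i j : Fin n} (hij : i ≠ j) (a : peirce e i j) :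
    diagAct he g (steinbergX e hij a) = steinbergX e hij (diagConj he g a) :=
  diagEnd_x he g hij a

theorem peirce_left {e : Fin n → R} (he : OrthogonalIdempotents e) {i j : Fin n}
    (a : peirce e i j) : e i * (a : R) = a := by
  obtain ⟨_, r, rfl⟩ := a
  rw [← mul_assoc, ← mul_assoc, (he.idem i).eq]

theorem peirce_right {e : Fin n → R} (he : OrthogonalIdempotents e) {i j : Fin n}
    (a : peirce e i j) : (a : R) * e j = a := by
  obtain ⟨_, r, rfl⟩ := a
  rw [mul_assoc, (he.idem j).eq]

/-- The element `d_i(a) = 1 + a - e_i` of `D(R)`, for `a` invertible in `R_ii` with inverse `b`. -/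
def diagElem {e : Fin n → R} (he : CompleteOrthogonalIdempotents e) (i : Fin n)
    (a b : peirce e i i) (hab : (a : R) * (b : R) = e i) (hba : (b : R) * (a : R) = e i) :
    diagGroup he :=
  ⟨{ val := 1 + a - e i
     inv := 1 + b - e i
     val_inv := by
      have h₁ := peirce_left he.toOrthogonalIdempotents b
      have h₂ := peirce_right he.toOrthogonalIdempotents a
      simp only [mul_sub, mul_add, sub_mul, add_mul, mul_one, one_mul, h₁, h₂, hab,
        (he.idem i).eq]
      abel
     inv_val := by
      have h₁ := peirce_left he.toOrthogonalIdempotents a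
      have h₂ := peirce_right he.toOrthogonalIdempotents b
      simp only [mul_sub, mul_add, sub_mul, add_mul, mul_one, one_mul, h₁, h₂, hba,
        (he.idem i).eq]
      abel }, by
    intro j k hjk
    have hjk' : e j * e k = 0 := he.ortho hjk
    have hi : e j * e i * e k = 0 := by
      by_cases h : j = i
      · subst h
        rw [(he.idem j).eq, hjk']
      · have h' : e j * e i = 0 := he.ortho h
        rw [h', zero_mul]
    have ha : e j * (a : R) * e k = 0 := by
      by_cases h : j = i
      · subst h
        rw [peirce_left he.toOrthogonalIdempotents, ← peirce_right he.toOrthogonalIdempotents a,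
          mul_assoc, hjk', mul_zero]
      · have h' : e j * e i = 0 := he.ortho h
        rw [← peirce_left he.toOrthogonalIdempotents a, ← mul_assoc, h', zero_mul, zero_mul]
    change e j * (1 + (a : R) - e i) * e k = 0
    simp only [mul_sub, mul_add, sub_mul, add_mul, mul_one, hi, ha, hjk', add_zero, sub_zero]⟩

/-- `d_i(a)` fixes `x_jk(c)` for `j ≠ i ≠ k`. -/
theorem diagAct_diagElem_of_ne {e : Fin n → R} (he : CompleteOrthogonalIdempotents e) {i : Fin n}
    (a b : peirce e i i) (hab : (a : R) * (b : R) = e i) (hba : (b : R) * (a : R) = e i)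
    {j k : Fin n} (hjk : j ≠ k) (hij : i ≠ j) (hki : k ≠ i) (c : peirce e j k) :
    diagAct he (diagElem he i a b hab hba) (steinbergX e hjk c) = steinbergX e hjk c := by
  rw [diagAct_x]
  congr 1
  ext
  have h₁ := peirce_mul_zero he.toOrthogonalIdempotents hij a c
  have h₂ := peirce_mul_zero he.toOrthogonalIdempotents hki c b
  have h₃ : e i * (c : R) = 0 := by
    have h' : e i * e j = 0 := he.ortho hij
    rw [← peirce_left he.toOrthogonalIdempotents c, ← mul_assoc, h', zero_mul]
  have h₄ : (c : R) * e i = 0 := by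
    have h' : e k * e i = 0 := he.ortho hki
    rw [← peirce_right he.toOrthogonalIdempotents c, mul_assoc, h', mul_zero]
  change (1 + (a : R) - e i) * (c : R) * (1 + (b : R) - e i) = c
  simp [mul_add, add_mul, mul_sub, sub_mul, h₁, h₂, h₃, h₄]

/-- `d_i(a)` sends `x_ij(c)` to `x_ij(a c)`. -/
theorem diagAct_diagElem_left {e : Fin n → R} (he : CompleteOrthogonalIdempotents e) {i j : Fin n}
    (a b : peirce e i i) (hab : (a : R) * (b : R) = e i) (hba : (b : R) * (a : R) = e i)
    (hij : i ≠ j) (c : peirce e i j) :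
    diagAct he (diagElem he i a b hab hba) (steinbergX e hij c) =
      steinbergX e hij (peirceMul a c) := by
  rw [diagAct_x]
  congr 1
  ext
  have h₁ := peirce_left he.toOrthogonalIdempotents c
  have h₂ := peirce_mul_zero he.toOrthogonalIdempotents hij.symm c b
  have h₃ : (c : R) * e i = 0 := by
    have h' : e j * e i = 0 := he.ortho hij.symm
    rw [← peirce_right he.toOrthogonalIdempotents c, mul_assoc, h', mul_zero]
  change (1 + (a : R) - e i) * (c : R) * (1 + (b : R) - e i) = (a : R) * (c : R)
  simp [mul_add, add_mul, mul_sub, sub_mul, h₁, h₂, h₃, mul_assoc]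

/-- `d_i(a)` sends `x_ji(c)` to `x_ji(c a⁻¹)`. -/
theorem diagAct_diagElem_right {e : Fin n → R} (he : CompleteOrthogonalIdempotents e) {i j : Fin n}
    (a b : peirce e i i) (hab : (a : R) * (b : R) = e i) (hba : (b : R) * (a : R) = e i)
    (hji : j ≠ i) (c : peirce e j i) :
    diagAct he (diagElem he i a b hab hba) (steinbergX e hji c) =
      steinbergX e hji (peirceMul c b) := by
  rw [diagAct_x]
  congr 1
  ext
  have h₁ := peirce_right he.toOrthogonalIdempotents c
  have h₂ := peirce_mul_zero he.toOrthogonalIdempotents hji.symm a c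
  have h₃ : e i * (c : R) = 0 := by
    have h' : e i * e j = 0 := he.ortho hji.symm
    rw [← peirce_left he.toOrthogonalIdempotents c, ← mul_assoc, h', zero_mul]
  change (1 + (a : R) - e i) * (c : R) * (1 + (b : R) - e i) = (c : R) * (b : R)
  simp [mul_add, add_mul, mul_sub, sub_mul, h₁, h₂, h₃]

/-- The homomorphism `st` preserves the action of `D(R)`. -/
theorem st_diagAct {e : Fin n → R} (he : CompleteOrthogonalIdempotents e) (g : diagGroup he)
    (x : Steinberg e) :
    st he.toOrthogonalIdempotents (diagAct he g x) =
      (g : Rˣ) * st he.toOrthogonalIdempotents x * (g : Rˣ)⁻¹ := by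
  have h : (st he.toOrthogonalIdempotents).comp (diagAct he g).toMonoidHom =
      (MulAut.conj (g : Rˣ)).toMonoidHom.comp (st he.toOrthogonalIdempotents) := by
    refine steinberg_hom_ext fun hij a => ?_
    simp only [MonoidHom.comp_apply, MulEquiv.coe_toMonoidHom, MulAut.conj_apply]
    rw [diagAct_x, st_x, st_x]
    ext
    simp [transvection, diagConj, mul_add, add_mul]
  exact DFunLike.congr_fun h x

/-- The semidirect product `St(R) ⋊ D(R)`. -/
abbrev SteinbergDiag {e : Fin n → R} (he : CompleteOrthogonalIdempotents e) : Type u :=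
  SemidirectProduct (Steinberg e) (diagGroup he) (diagAct he)

/-- The homomorphism `St(R) ⋊ D(R) → GL(R)`, `(x, g) ↦ st(x) g`. -/
def steinbergDiagToGL {e : Fin n → R} (he : CompleteOrthogonalIdempotents e) :
    SteinbergDiag he →* Rˣ :=
  SemidirectProduct.lift (st he.toOrthogonalIdempotents) (diagGroup he).subtype (by
    intro g
    refine MonoidHom.ext fun x => ?_
    exact st_diagAct he g x)

/-- The action of `St(R) ⋊ D(R)` on `St(R)`: `St(R)` acts by conjugation and `D(R)` by `diagAct`,
so `(x, g)` sends `y` to `x (ᵍy) x⁻¹`. -/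
def steinbergDiagAct {e : Fin n → R} (he : CompleteOrthogonalIdempotents e) :
    SteinbergDiag he →* MulAut (Steinberg e) :=
  SemidirectProduct.lift MulAut.conj (diagAct he) (by
    intro g
    ext x y
    simp)

end

end IsotropicGL

/-!
The map `St(R) ⋊ D(R) → GL(R)` is surjective by Gaussian elimination, since a semi-local ring has
stable rank one. So the action of `St(R) ⋊ D(R)` descends to `GL(R)` as soon as the kernel of this
map acts trivially.

An element of the kernel whose `St(R)`-part lies in a proper Levi subgroup normalizes the two
opposite unipotent radicals. These embed in `GL(R)`, so the element centralizes them, and they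
generate `St(R)`; hence it acts trivially. As `n ≥ 3`, this covers the Levi subgroups of rank one,
in which stable rank one therefore gives Gauss decompositions `U⁺ U⁻ U⁺ D` modulo elements acting
trivially. Multiplying by one simple root element at a time extends such decompositions to all of
`St(R)`. Finally, if `u v u' d = 1` in `GL(R)`, then `v` is both lower unitriangular and upper
triangular, so `v = 1`, whence `u u' = 1` and `d = 1`.

Uniqueness and consistency hold because `St(R)` is perfect and the kernel of a crossed module is
central: two automorphisms of `St(R)` inducing the same map on the image of `st` differ by central
factors, which commutators do not see.
-/

namespace IsotropicGL

open scoped commutatorElement Pointwise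

section StableRank

/-- Bass's stable range condition `sr(R) = 1`. -/
def HasStableRankOne (R : Type*) [Ring R] : Prop :=
  ∀ x x' y y' : R, x' * x + y' * y = 1 → ∃ p, IsUnit (x + p * y)

theorem HasStableRankOne.of_isLocalHom {R S F : Type*} [Ring R] [Ring S] [FunLike F R S]
    [RingHomClass F R S] (f : F) [IsLocalHom f]
    (hf : Function.Surjective f) (hS : HasStableRankOne S) : HasStableRankOne R := by
  intro x x' y y' h
  obtain ⟨q, hq⟩ := hS (f x) (f x') (f y) (f y') (by simpa using congrArg f h)
  obtain ⟨p, rfl⟩ := hf q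
  exact ⟨p, isUnit_of_map_unit f _ (by simpa using hq)⟩

theorem HasStableRankOne.pi {ι : Type*} {S : ι → Type*} [∀ i, Ring (S i)]
    (h : ∀ i, HasStableRankOne (S i)) : HasStableRankOne (∀ i, S i) := by
  intro x x' y y' hxy
  choose p hp using fun i => h i (x i) (x' i) (y i) (y' i) (congrFun hxy i)
  exact ⟨p, Pi.isUnit_iff.2 hp⟩

theorem hasStableRankOne_end (D V : Type*) [DivisionRing D] [AddCommGroup V] [Module D V]
    [FiniteDimensional D V] : HasStableRankOne (Module.End D V) := by
  -- `y` is injective on `ker x`, so some `p` maps `y (ker x)` isomorphically onto a complement of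
  -- `range x`.
  intro x x' y y' h
  have eq_zero {v : V} (hx : x v = 0) (hy : y v = 0) : v = 0 := by
    simpa [hx, hy] using (DFunLike.congr_fun h v).symm
  obtain ⟨s, hs⟩ := (y ∘ₗ (LinearMap.ker x).subtype).exists_leftInverse_of_injective <|
    LinearMap.ker_eq_bot'.2 fun v hv => Subtype.ext (eq_zero v.2 hv)
  obtain ⟨C, hC⟩ := (LinearMap.range x).exists_isCompl
  have hdim : Module.finrank D (LinearMap.ker x) = Module.finrank D C := by
    have h₁ := x.finrank_range_add_finrank_ker
    have h₂ := Submodule.finrank_add_eq_of_isCompl hC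
    omega
  let θ := LinearEquiv.ofFinrankEq _ _ hdim
  let p : Module.End D V := C.subtype ∘ₗ θ.toLinearMap ∘ₗ s
  have hinj : Function.Injective (x + p * y) := by
    refine LinearMap.ker_eq_bot.1 (LinearMap.ker_eq_bot'.2 fun v hv => ?_)
    obtain ⟨hx, hp⟩ := (Submodule.disjoint_iff_add_eq_zero.1 hC.disjoint)
      (LinearMap.mem_range_self x v) (θ (s (y v))).2 hv
    have hsy : s (y v) = ⟨v, hx⟩ := DFunLike.congr_fun hs ⟨v, hx⟩
    have hv : (⟨v, hx⟩ : LinearMap.ker x) = 0 := by simpa [hsy] using hp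
    exact congrArg Subtype.val hv
  exact ⟨p, (Module.End.isUnit_iff _).2 ⟨hinj, LinearMap.injective_iff_surjective.1 hinj⟩⟩

theorem hasStableRankOne_matrix (ι D : Type*) [Fintype ι] [DecidableEq ι] [DivisionRing D] :
    HasStableRankOne (Matrix ι ι D) := by
  have : Module.Finite Dᵐᵒᵖ D :=
    .of_surjective (LinearMap.toSpanSingleton Dᵐᵒᵖ D 1) fun d => ⟨.op d, by simp⟩
  let f : Matrix ι ι D ≃+* Module.End Dᵐᵒᵖ (ι → D) :=
    (RingEquiv.moduleEndSelfOp D).mapMatrix.trans (endVecRingEquivMatrixEnd ι Dᵐᵒᵖ D).symm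
  exact .of_isLocalHom f f.surjective (hasStableRankOne_end _ _)

theorem exists_mul_eq_one_of_isUnit_mk_jacobson {R : Type*} [Ring R] {a : R}
    (ha : IsUnit (Ideal.Quotient.mk (Ring.jacobson R) a)) : ∃ b, b * a = 1 := by
  obtain ⟨u, hu⟩ := ha
  obtain ⟨b, hb⟩ := Ideal.Quotient.mk_surjective (↑u⁻¹ : R ⧸ Ring.jacobson R)
  have hba : b * a - 1 ∈ Ideal.jacobson (⊥ : Ideal R) := by
    rw [Ideal.jacobson_bot, ← Ideal.Quotient.mk_eq_mk_iff_sub_mem, map_mul, map_one, hb, ← hu,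
      u.inv_mul]
  obtain ⟨c, hc⟩ := Ideal.exists_mul_sub_mem_of_sub_one_mem_jacobson _ hba
  exact ⟨c * b, by rw [mul_assoc]; exact sub_eq_zero.1 hc⟩

instance isLocalHom_mk_jacobson (R : Type*) [Ring R] :
    IsLocalHom (Ideal.Quotient.mk (Ring.jacobson R)) where
  map_nonunit a ha := by
    obtain ⟨b, hba⟩ := exists_mul_eq_one_of_isUnit_mk_jacobson ha
    have hb : IsUnit (Ideal.Quotient.mk (Ring.jacobson R) b) := by
      obtain ⟨u, hu⟩ := ha
      have h : Ideal.Quotient.mk (Ring.jacobson R) b = ↑u⁻¹ := by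
        rw [← Units.mul_eq_one_iff_eq_inv, hu, ← map_mul, hba, map_one]
      exact h ▸ u⁻¹.isUnit
    obtain ⟨c, hcb⟩ := exists_mul_eq_one_of_isUnit_mk_jacobson hb
    have hca : c = a := left_inv_eq_right_inv hcb hba
    exact ⟨⟨a, b, hca ▸ hcb, hba⟩, rfl⟩

theorem IsSemiLocalRing.hasStableRankOne {R : Type*} [Ring R] (hR : IsSemiLocalRing R) :
    HasStableRankOne R := by
  obtain ⟨m, D, d, _, ⟨f⟩⟩ := (isSemiLocalRing_iff R).1 hR
  have hpi := HasStableRankOne.pi fun i => hasStableRankOne_matrix (Fin (d i)) (D i)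
  exact .of_isLocalHom _ Ideal.Quotient.mk_surjective <|
    .of_isLocalHom f f.surjective hpi

end StableRank

section Corner

variable {R : Type*} [Ring R]

theorem corner_mul_corner {e a b : R} (he : IsIdempotentElem e) (hab : a * b = 1)
    (ha : a * (1 - e) = 1 - e) : e * a * e * (e * b * e) = e := by
  have haeb : a * e * b = 1 - (1 - e) * b := by
    calc a * e * b = a * b - a * (1 - e) * b := by noncomm_ring
      _ = 1 - (1 - e) * b := by rw [hab, ha]
  calc e * a * e * (e * b * e) = e * (a * (e * e) * b) * e := by noncomm_ring
    _ = e * (1 - (1 - e) * b) * e := by rw [he.eq, haeb]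
    _ = e * e - (e - e * e) * b * e := by noncomm_ring
    _ = e := by rw [he.eq, sub_self, zero_mul, zero_mul, sub_zero]

theorem HasStableRankOne.exists_corner_inverse (hR : HasStableRankOne R) {e x x' y y' : R}
    (he : IsIdempotentElem e) (hex : e * x = x) (hxe : x * e = x) (hye : y * e = y)
    (h : x' * x + y' * y = e) :
    ∃ p u, (x + e * p * y) * (e * u * e) = e ∧ e * u * e * (x + e * p * y) = e := by
  have h1 : (e * x' * e + (1 - e)) * (x + (1 - e)) + e * y' * y = 1 := by
    calc (e * x' * e + (1 - e)) * (x + (1 - e)) + e * y' * y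
        = e * (x' * (e * x) + y' * y) + (x - e * x) + (1 - e) + (e * e - e)
            + e * x' * (e - e * e) := by noncomm_ring
      _ = 1 := by rw [hex, h, he.eq]; noncomm_ring
  obtain ⟨p, w, hw⟩ := hR _ _ _ _ h1
  have hx1 : x * (1 - e) = 0 := by rw [mul_sub, mul_one, hxe, sub_self]
  have hy1 : y * (1 - e) = 0 := by rw [mul_sub, mul_one, hye, sub_self]
  have hw1 : (w : R) * (1 - e) = 1 - e := by
    rw [hw, add_mul, add_mul, hx1, mul_assoc, hy1, he.one_sub.eq, mul_zero, zero_add, add_zero]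
  have hw1' : (↑w⁻¹ : R) * (1 - e) = 1 - e := by rw [Units.inv_mul_eq_iff_eq_mul, hw1]
  have hcorner : e * w * e = x + e * p * y := by
    calc e * w * e = e * x * e + (e - e * e) * e + e * p * (y * e) := by rw [hw]; noncomm_ring
      _ = x + e * p * y := by rw [he.eq, hex, hxe, hye]; noncomm_ring
  refine ⟨p, ↑w⁻¹, ?_⟩
  rw [← hcorner]
  exact ⟨corner_mul_corner he w.mul_inv hw1, corner_mul_corner he w.inv_mul hw1'⟩

theorem commute_one_add_mul_mul {a b c : R} (p : R) (hca : c * a = 0) (hbc : b * c = 0) :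
    Commute (1 + a * p * b) c := by
  have hl : a * p * b * c = 0 := by rw [mul_assoc, hbc, mul_zero]
  have hr : c * (a * p * b) = 0 := by rw [← mul_assoc, ← mul_assoc, hca, zero_mul, zero_mul]
  exact .add_left (.one_left c) (hl.trans hr.symm)

theorem commute_one_add_mul_mul_add {e f : R} (p : R) (he : IsIdempotentElem e)
    (hf : IsIdempotentElem f) (hfe : f * e = 0) : Commute (1 + e * p * f) (e + f) := by
  refine .add_left (.one_left _) ?_
  calc e * p * f * (e + f) = e * p * (f * e) + e * p * (f * f) := by noncomm_ring
    _ = e * e * p * f + f * e * p * f := by rw [he.eq, hf.eq, hfe]; noncomm_ring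
    _ = (e + f) * (e * p * f) := by noncomm_ring

theorem commute_of_commute_add {e f m : R} (he : IsIdempotentElem e) (hef : e * f = 0)
    (hfe : f * e = 0) (hm : Commute m (e + f)) (hemf : e * m * f = 0) (hfme : f * m * e = 0) :
    Commute m e :=
  calc m * e = m * (e + f) * e := by rw [mul_assoc, add_mul, he.eq, hfe, add_zero]
    _ = e * m * e + f * m * e := by rw [hm.eq]; noncomm_ring
    _ = e * (m * (e + f)) := by rw [hfme, mul_add, mul_add, ← mul_assoc e m f, hemf, mul_assoc]
    _ = e * m := by rw [hm.eq, ← mul_assoc, mul_add, he.eq, hef, add_zero]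

theorem commute_of_corner_inverse {e f m u : R} (he : IsIdempotentElem e)
    (hf : IsIdempotentElem f) (hef : e * f = 0) (hfe : f * e = 0) (hm : Commute m (e + f))
    (hmu : e * m * e * (e * u * e) = e) (hum : e * u * e * (e * m * e) = e) :
    Commute ((1 + f * (-(m * e * u)) * e) * m * (1 + e * (-(u * e * m)) * f)) e := by
  refine commute_of_commute_add he hef hfe (.mul_left (.mul_left ?_ hm) ?_) ?_ ?_
  · rw [add_comm e f]
    exact commute_one_add_mul_mul_add _ hf he hef
  · exact commute_one_add_mul_mul_add _ he hf hfe
  · calc _ = (e + e * f * (-(m * e * u)) * e) * m * (f - e * (u * e * m) * (f * f)) := by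
          noncomm_ring
      _ = e * m * f - e * m * (e * e) * u * e * m * f := by
          rw [hef, he.eq, hf.eq]; noncomm_ring
      _ = e * m * f - e * m * e * (e * u * e) * (m * f) := by noncomm_ring
      _ = 0 := by rw [hmu]; noncomm_ring
  · calc _ = (f - f * f * (m * e * u) * e) * m * (e + e * (-(u * e * m)) * (f * e)) := by
          noncomm_ring
      _ = f * m * e - f * m * e * u * (e * e) * m * e := by
          rw [hfe, he.eq, hf.eq]; noncomm_ring
      _ = f * m * e - f * m * (e * u * e * (e * m * e)) := by noncomm_ring
      _ = 0 := by rw [hum]; noncomm_ring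

theorem HasStableRankOne.exists_commute (hR : HasStableRankOne R) {e f : R}
    (he : IsIdempotentElem e) (hf : IsIdempotentElem f) (hef : e * f = 0) (hfe : f * e = 0)
    (g : Rˣ) (hg : Commute (g : R) (e + f)) :
    ∃ p q r : R, Commute ((1 + f * q * e) * ((1 + e * p * f) * g) * (1 + e * r * f)) e := by
  have hcol : e * ↑g⁻¹ * e * (e * g * e) + e * ↑g⁻¹ * f * (f * g * e) = e := by
    calc e * ↑g⁻¹ * e * (e * g * e) + e * ↑g⁻¹ * f * (f * g * e)
        = e * ↑g⁻¹ * (e * e) * g * e + e * ↑g⁻¹ * (f * f) * g * e := by noncomm_ring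
      _ = e * ↑g⁻¹ * ((e + f) * g) * e := by rw [he.eq, hf.eq]; noncomm_ring
      _ = e * (↑g⁻¹ * g) * (e + f) * e := by rw [← hg.eq]; noncomm_ring
      _ = e := by rw [g.inv_mul, mul_one, mul_assoc, add_mul, hfe, add_zero, he.eq, he.eq]
  obtain ⟨p, u, hxu, hux⟩ := hR.exists_corner_inverse he (by simp only [← mul_assoc, he.eq])
    (by simp only [mul_assoc, he.eq]) (by simp only [mul_assoc, he.eq]) hcol
  have hcorner : e * g * e + e * p * (f * g * e) = e * ((1 + e * p * f) * g) * e := by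
    calc _ = e * g * e + e * e * p * f * g * e := by rw [he.eq]; noncomm_ring
      _ = _ := by noncomm_ring
  rw [hcorner] at hxu hux
  exact ⟨p, _, _, commute_of_corner_inverse he hf hef hfe
    (.mul_left (commute_one_add_mul_mul_add p he hf hfe) hg) hxu hux⟩

end Corner

section Peirce

variable {R : Type*} [Ring R] {n : ℕ} {e : Fin n → R}

/-- The projection `a ↦ e_i a e_j` of `R` onto its Peirce component `R_ij`. -/
def peirceProj (e : Fin n → R) (i j : Fin n) : R →+ peirce e i j where
  toFun a := ⟨e i * a * e j, a, rfl⟩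
  map_zero' := by ext; simp
  map_add' a b := by ext; simp [mul_add, add_mul]

@[simp]
theorem coe_peirceProj (i j : Fin n) (a : R) : (peirceProj e i j a : R) = e i * a * e j :=
  rfl

section Complete

variable (he : CompleteOrthogonalIdempotents e)
include he

theorem ext_peirce {a b : R} (h : ∀ i j, e i * a * e j = e i * b * e j) : a = b := by
  have expand (c : R) : c = ∑ i, ∑ j, e i * c * e j := by
    simp only [← Finset.mul_sum, ← Finset.sum_mul, he.complete, one_mul, mul_one]
  rw [expand a, expand b]
  simp only [h]

theorem mul_mul_mul_eq_sum (a b c d : R) : a * (b * c) * d = ∑ k, a * b * e k * (e k * c * d) := by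
  calc a * (b * c) * d = a * b * (∑ k, e k) * (c * d) := by
        rw [he.complete]
        noncomm_ring
    _ = ∑ k, a * b * e k * (e k * c * d) := by
        simp only [Finset.mul_sum, Finset.sum_mul, mul_assoc]
        simp only [← mul_assoc (e _) (e _), (he.idem _).eq]

theorem commute_sum_of_forall_notMem {g : R} {s : Finset (Fin n)}
    (hg : ∀ l, l ∉ s → Commute g (e l)) : Commute g (∑ l ∈ s, e l) := by
  have h : ∑ l ∈ s, e l = 1 - ∑ l ∈ sᶜ, e l := by
    rw [← he.complete, ← Finset.sum_add_sum_compl s, add_sub_cancel_right]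
  rw [h]
  exact .sub_right (.one_right g) (.sum_right _ _ _ fun l hl => hg l (Finset.mem_compl.1 hl))

theorem HasStableRankOne.exists_commute_forall_notMem (hR : HasStableRankOne R) {i : Fin n}
    {t : Finset (Fin n)} (hi : i ∉ t) {g : Rˣ}
    (hg : ∀ l, l ∉ insert i t → Commute (g : R) (e l)) :
    ∃ p q r : R, ∀ l, l ∉ t → Commute ((1 + (∑ j ∈ t, e j) * q * e i) *
      ((1 + e i * p * ∑ j ∈ t, e j) * g) * (1 + e i * r * ∑ j ∈ t, e j)) (e l) := by
  have hel {l : Fin n} (hl : l ∉ t) : e l * ∑ j ∈ t, e j = 0 := he.mul_sum_of_notMem hl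
  have hle {l : Fin n} (hl : l ∉ t) : (∑ j ∈ t, e j) * e l = 0 := by
    simp [Finset.sum_mul, he.mul_eq, hl]
  have hsum := commute_sum_of_forall_notMem he hg
  rw [Finset.sum_insert hi] at hsum
  obtain ⟨p, q, r, h⟩ :=
    hR.exists_commute (he.idem i) he.isIdempotentElem_sum (hel hi) (hle hi) g hsum
  refine ⟨p, q, r, fun l hl => ?_⟩
  obtain rfl | hli := eq_or_ne l i
  · exact h
  · have hil : e l * e i = 0 := he.ortho hli
    have hli' : e i * e l = 0 := he.ortho hli.symm
    exact .mul_left (.mul_left (commute_one_add_mul_mul _ (hel hl) hli') (.mul_left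
      (commute_one_add_mul_mul _ hil (hle hl)) (hg l (by simp [hli, hl]))))
      (commute_one_add_mul_mul _ hil (hle hl))

theorem mem_diagGroup_of_commute {g : Rˣ} (hg : ∀ i, Commute (g : R) (e i)) :
    g ∈ diagGroup he := by
  intro i j hij
  have hij' : e i * e j = 0 := he.ortho hij
  rw [mul_assoc, (hg j).eq, ← mul_assoc, hij', zero_mul]

end Complete

end Peirce

section Generators

variable {R : Type*} [Ring R] {n : ℕ} {e : Fin n → R} {i j k : Fin n}

theorem steinbergX_zero (hij : i ≠ j) : steinbergX e hij (0 : peirce e i j) = 1 :=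
  (mul_eq_left (a := steinbergX e hij 0)).1 (by rw [steinbergX_add, add_zero])

theorem steinbergX_neg (hij : i ≠ j) (a : peirce e i j) :
    steinbergX e hij (-a) = (steinbergX e hij a)⁻¹ := by
  rw [eq_inv_iff_mul_eq_one, steinbergX_add, neg_add_cancel, steinbergX_zero]

theorem conj_steinbergX_of_ne {l : Fin n} (hij : i ≠ j) (hkl : k ≠ l) (hjk : j ≠ k) (hil : i ≠ l)
    (a : peirce e i j) (b : peirce e k l) :
    MulAut.conj (steinbergX e hij a) (steinbergX e hkl b) = steinbergX e hkl b := by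
  have h := steinbergX_comm hij hkl hjk hil a b
  rwa [commutatorElement_def, mul_inv_eq_one] at h

theorem conj_steinbergX_right (hij : i ≠ j) (hjk : j ≠ k) (hik : i ≠ k) (a : peirce e i j)
    (b : peirce e j k) :
    MulAut.conj (steinbergX e hij a) (steinbergX e hjk b) =
      steinbergX e hik (peirceMul a b) * steinbergX e hjk b := by
  rw [← steinbergX_mul hij hjk hik, commutatorElement_def, MulAut.conj_apply,
    inv_mul_cancel_right]

theorem conj_steinbergX_left (hij : i ≠ j) (hki : k ≠ i) (hkj : k ≠ j) (a : peirce e i j)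
    (b : peirce e k i) :
    MulAut.conj (steinbergX e hij a) (steinbergX e hki b) =
      steinbergX e hkj (-peirceMul b a) * steinbergX e hki b := by
  rw [steinbergX_neg, ← steinbergX_mul hki hij hkj, commutatorElement_inv, commutatorElement_def,
    MulAut.conj_apply, inv_mul_cancel_right]

theorem st_steinbergX_val (he : OrthogonalIdempotents e) (hij : i ≠ j) (a : peirce e i j) :
    (st he (steinbergX e hij a) : R) = 1 + a := by
  rw [st_x]
  rfl

theorem idem_mul_peirce (he : OrthogonalIdempotents e) (hki : k ≠ i) (a : peirce e i j) :
    e k * (a : R) = 0 := by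
  have h : e k * e i = 0 := he.ortho hki
  rw [← peirce_left he a, ← mul_assoc, h, zero_mul]

theorem steinbergX_mem_of_forall_commutator (he : OrthogonalIdempotents e)
    (hM : MoritaDominates (e k) (e i)) (hij : i ≠ j) (hik : i ≠ k) (hkj : k ≠ j)
    {H : Subgroup (Steinberg e)}
    (hH : ∀ b c, ⁅steinbergX e hik b, steinbergX e hkj c⁆ ∈ H) (a : peirce e i j) :
    steinbergX e hij a ∈ H := by
  have hmem : steinbergX e hij (peirceProj e i j (e i * a)) ∈ H := by
    refine AddSubgroup.closure_induction
      (p := fun x _ => steinbergX e hij (peirceProj e i j (x * a)) ∈ H) ?_ ?_ ?_ ?_ hM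
    · rintro _ ⟨r, s, rfl⟩
      have hrs : peirceProj e i j (r * e k * s * a) =
          peirceMul (peirceProj e i k r) (peirceProj e k j (s * a)) := by
        ext
        simp only [coe_peirceProj, peirceMul, mul_assoc]
        rw [← mul_assoc (e k) (e k), (he.idem k).eq]
      rw [hrs, ← steinbergX_mul hik hkj hij]
      exact hH _ _
    · rw [zero_mul, map_zero, steinbergX_zero]
      exact one_mem H
    · intro x y _ _ hx hy
      rw [add_mul, map_add, ← steinbergX_add]
      exact mul_mem hx hy
    · intro x _ hx
      rw [neg_mul, map_neg, steinbergX_neg]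
      exact inv_mem hx
  have ha : peirceProj e i j (e i * a) = a := by
    ext
    rw [coe_peirceProj, peirce_left he, peirce_left he, peirce_right he]
  rwa [ha] at hmem

end Generators

section RootSubgroups

variable {R : Type*} [Ring R] {n : ℕ} {e : Fin n → R} {Ψ : Set (Fin n × Fin n)} {i j : Fin n}

/-- The subgroup of the Steinberg group generated by the `x_ij(a)` with `(i, j) ∈ Ψ`. The pair
`(i, j)` stands for the root `ε_i - ε_j`; pairs `(i, i)` contribute nothing. -/
def rootSubgroup (e : Fin n → R) (Ψ : Set (Fin n × Fin n)) : Subgroup (Steinberg e) :=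
  Subgroup.closure {x | ∃ (i j : Fin n) (hij : i ≠ j) (a : peirce e i j),
    (i, j) ∈ Ψ ∧ x = steinbergX e hij a}

theorem rootSubgroup_le_iff {K : Subgroup (Steinberg e)} :
    rootSubgroup e Ψ ≤ K ↔ ∀ {i j : Fin n} (hij : i ≠ j) (a : peirce e i j), (i, j) ∈ Ψ →
      steinbergX e hij a ∈ K := by
  rw [rootSubgroup, Subgroup.closure_le]
  constructor
  · exact fun h i j hij a hΨ => h ⟨i, j, hij, a, hΨ, rfl⟩
  · rintro h _ ⟨i, j, hij, a, hΨ, rfl⟩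
    exact h hij a hΨ

theorem steinbergX_mem_rootSubgroup (hij : i ≠ j) (h : (i, j) ∈ Ψ) (a : peirce e i j) :
    steinbergX e hij a ∈ rootSubgroup e Ψ :=
  rootSubgroup_le_iff.1 le_rfl hij a h

theorem rootSubgroup_mono {Φ : Set (Fin n × Fin n)} (h : Φ ⊆ Ψ) :
    rootSubgroup e Φ ≤ rootSubgroup e Ψ :=
  rootSubgroup_le_iff.2 fun hij a ha => steinbergX_mem_rootSubgroup hij (h ha) a

theorem rootSubgroup_univ : rootSubgroup e Set.univ = ⊤ := by
  rw [eq_top_iff, ← PresentedGroup.closure_range_of, Subgroup.closure_le]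
  rintro _ ⟨g, rfl⟩
  exact steinbergX_mem_rootSubgroup g.ne (Set.mem_univ _) g.val

theorem rootSubgroup_induction {P : Steinberg e → Prop} (one : P 1)
    (mul : ∀ {i j : Fin n} (hij : i ≠ j) (a : peirce e i j), (i, j) ∈ Ψ →
      ∀ y, P y → P (steinbergX e hij a * y))
    {x : Steinberg e} (hx : x ∈ rootSubgroup e Ψ) : P x := by
  induction hx using Subgroup.closure_induction_left with
  | one => exact one
  | mul_left x hx y _ hy =>
    obtain ⟨i, j, hij, a, ha, rfl⟩ := hx
    exact mul hij a ha y hy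
  | inv_mul_cancel x hx y _ hy =>
    obtain ⟨i, j, hij, a, ha, rfl⟩ := hx
    rw [← steinbergX_neg]
    exact mul hij (-a) ha y hy

theorem isPerfect_steinberg (hn : 3 ≤ n) (he : OrthogonalIdempotents e)
    (hM : ∀ i j, MoritaDominates (e i) (e j)) : Group.IsPerfect (Steinberg e) := by
  refine Group.isPerfect_def.2 (top_unique ?_)
  rw [← rootSubgroup_univ, rootSubgroup_le_iff]
  intro i j hij a _
  obtain ⟨k, hki, hkj⟩ := Fin.exists_ne_and_ne_of_two_lt i j hn
  exact steinbergX_mem_of_forall_commutator he (hM k i) hij hki.symm hkj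
    (fun b c => Subgroup.commutator_mem_commutator (Subgroup.mem_top _) (Subgroup.mem_top _)) a

theorem diagAct_mem_rootSubgroup (he : CompleteOrthogonalIdempotents e) (d : diagGroup he)
    {x : Steinberg e} (hx : x ∈ rootSubgroup e Ψ) : diagAct he d x ∈ rootSubgroup e Ψ := by
  suffices h : rootSubgroup e Ψ ≤ (rootSubgroup e Ψ).comap (diagAct he d).toMonoidHom from h hx
  refine rootSubgroup_le_iff.2 fun hij a hΨ => ?_
  rw [Subgroup.mem_comap, MulEquiv.coe_toMonoidHom, diagAct_x]
  exact steinbergX_mem_rootSubgroup hij hΨ _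

theorem idem_mul_st_sub_one_mul_idem (he : OrthogonalIdempotents e)
    (hΨ : ∀ {i j k}, (i, j) ∈ Ψ → (j, k) ∈ Ψ → (i, k) ∈ Ψ) {x : Steinberg e}
    (hx : x ∈ rootSubgroup e Ψ) (hij : (i, j) ∉ Ψ) : e i * ((st he x : R) - 1) * e j = 0 := by
  refine rootSubgroup_induction (P := fun x => ∀ i, (i, j) ∉ Ψ →
    e i * ((st he x : R) - 1) * e j = 0) (by simp) ?_ hx i hij
  intro k l hkl a ha y hy i hij
  have expand : e i * ((st he (steinbergX e hkl a * y) : R) - 1) * e j =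
      e i * a * e j + e i * ((st he y : R) - 1) * e j +
        e i * a * (e l * ((st he y : R) - 1) * e j) := by
    rw [map_mul, Units.val_mul, st_steinbergX_val]
    simp only [← mul_assoc, mul_assoc (e i) (a : R) (e l), peirce_right he]
    noncomm_ring
  rw [expand, hy i hij, add_zero]
  obtain rfl | hik := eq_or_ne i k
  · have hlj : l ≠ j := by
      rintro rfl
      exact hij ha
    have hlj' : e l * e j = 0 := he.ortho hlj
    rw [hy l fun h => hij (hΨ ha h), mul_zero, add_zero, peirce_left he, ← peirce_right he a,
      mul_assoc, hlj', mul_zero]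
  · simp only [idem_mul_peirce he hik, zero_mul, add_zero]

/-- The root `(i, j)` normalizes `Ψ` if its opposite is not in `Ψ` and adding `(i, j)` to an
element of `Ψ` does not leave `Ψ`. -/
structure IsNormalizingRoot (i j : Fin n) (Ψ : Set (Fin n × Fin n)) : Prop where
  opposite_notMem : (j, i) ∉ Ψ
  add_left_mem : ∀ {l}, (j, l) ∈ Ψ → (i, l) ∈ Ψ
  add_right_mem : ∀ {k}, (k, i) ∈ Ψ → (k, j) ∈ Ψ

theorem IsNormalizingRoot.conj_mem (h : IsNormalizingRoot i j Ψ) (hij : i ≠ j) (a : peirce e i j)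
    {x : Steinberg e} (hx : x ∈ rootSubgroup e Ψ) :
    MulAut.conj (steinbergX e hij a) x ∈ rootSubgroup e Ψ := by
  suffices hle : rootSubgroup e Ψ ≤
    (rootSubgroup e Ψ).comap (MulAut.conj (steinbergX e hij a)).toMonoidHom from hle hx
  refine rootSubgroup_le_iff.2 fun {k l} hkl b hΨ => ?_
  rw [Subgroup.mem_comap, MulEquiv.coe_toMonoidHom]
  have hb := steinbergX_mem_rootSubgroup hkl hΨ b
  obtain rfl | hjk := eq_or_ne j k
  · obtain rfl | hil := eq_or_ne i l
    · exact absurd hΨ h.opposite_notMem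
    · rw [conj_steinbergX_right hij hkl hil]
      exact mul_mem (steinbergX_mem_rootSubgroup hil (h.add_left_mem hΨ) _) hb
  · obtain rfl | hil := eq_or_ne i l
    · rw [conj_steinbergX_left hij hkl hjk.symm]
      exact mul_mem (steinbergX_mem_rootSubgroup hjk.symm (h.add_right_mem hΨ) _) hb
    · rwa [conj_steinbergX_of_ne hij hkl hjk hil]

theorem IsNormalizingRoot.steinbergX_mem_normalizer (h : IsNormalizingRoot i j Ψ) (hij : i ≠ j)
    (a : peirce e i j) :
    steinbergX e hij a ∈ Subgroup.normalizer (rootSubgroup e Ψ : Set (Steinberg e)) := by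
  refine Subgroup.mem_normalizer_iff.2 fun x => ⟨fun hx => h.conj_mem hij a hx, fun hx => ?_⟩
  simpa [steinbergX_neg, mul_assoc] using h.conj_mem hij (-a) hx

theorem IsNormalizingRoot.exists_mul_steinbergX (h : IsNormalizingRoot i j Ψ) (hij : i ≠ j)
    {x : Steinberg e} (hx : x ∈ rootSubgroup e (insert (i, j) Ψ)) :
    ∃ p ∈ rootSubgroup e Ψ, ∃ b : peirce e i j, x = p * steinbergX e hij b := by
  refine rootSubgroup_induction
    (P := fun x => ∃ p ∈ rootSubgroup e Ψ, ∃ b : peirce e i j, x = p * steinbergX e hij b)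
    ⟨1, one_mem _, 0, by rw [steinbergX_zero, one_mul]⟩ ?_ hx
  rintro k l hkl a (hkl' | hkl') _ ⟨p, hp, b, rfl⟩
  · obtain ⟨rfl, rfl⟩ := Prod.mk.inj hkl'
    refine ⟨_, h.conj_mem hkl a hp, a + b, ?_⟩
    rw [← steinbergX_add, MulAut.conj_apply]
    group
  · exact ⟨_, mul_mem (steinbergX_mem_rootSubgroup hkl hkl' a) hp, b, (mul_assoc _ _ _).symm⟩

theorem IsNormalizingRoot.exists_steinbergX_mul (h : IsNormalizingRoot i j Ψ) (hij : i ≠ j)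
    {x : Steinberg e} (hx : x ∈ rootSubgroup e (insert (i, j) Ψ)) :
    ∃ p ∈ rootSubgroup e Ψ, ∃ b : peirce e i j, x = steinbergX e hij b * p := by
  obtain ⟨p, hp, b, hb⟩ := h.exists_mul_steinbergX hij (inv_mem hx)
  exact ⟨p⁻¹, inv_mem hp, -b, by rw [steinbergX_neg, ← mul_inv_rev, ← hb, inv_inv]⟩

/-- A transitive and irreflexive set of pairs, that is, a closed set of roots without opposite
roots. -/
structure IsUnipotentRootSet (Ψ : Set (Fin n × Fin n)) : Prop where
  irrefl : ∀ i, (i, i) ∉ Ψ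
  trans : ∀ {i j k}, (i, j) ∈ Ψ → (j, k) ∈ Ψ → (i, k) ∈ Ψ

namespace IsUnipotentRootSet

theorem ne (hΨ : IsUnipotentRootSet Ψ) (h : (i, j) ∈ Ψ) : i ≠ j := by
  rintro rfl
  exact hΨ.irrefl _ h

theorem prod {s t : Set (Fin n)} (hst : Disjoint s t) : IsUnipotentRootSet (s ×ˢ t) where
  irrefl _ h := Set.disjoint_left.1 hst h.1 h.2
  trans h h' := ⟨h.1, h'.2⟩

theorem isNormalizingRoot_diff (hΨ : IsUnipotentRootSet Ψ) (h : (i, j) ∈ Ψ) :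
    IsNormalizingRoot i j (Ψ \ {(i, j)}) where
  opposite_notMem h' := hΨ.irrefl _ (hΨ.trans h h'.1)
  add_left_mem hjl := ⟨hΨ.trans h hjl.1, fun h' => hΨ.ne hjl.1 (Prod.mk.inj h').2.symm⟩
  add_right_mem hki := ⟨hΨ.trans hki.1 h, fun h' => hΨ.ne hki.1 (Prod.mk.inj h').1⟩

end IsUnipotentRootSet

/-- The root `(i, j)` is simple in `Ψ` if it is not a sum of two elements of `Ψ`. -/
structure IsSimpleRoot (Ψ : Set (Fin n × Fin n)) (i j : Fin n) : Prop where
  mem : (i, j) ∈ Ψ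
  notMem_of_mem : ∀ {k}, (i, k) ∈ Ψ → (k, j) ∉ Ψ

namespace IsUnipotentRootSet

theorem diff_simpleRoot (hΨ : IsUnipotentRootSet Ψ) (h : IsSimpleRoot Ψ i j) :
    IsUnipotentRootSet (Ψ \ {(i, j)}) where
  irrefl k hk := hΨ.irrefl k hk.1
  trans {a b c} hab hbc := by
    refine ⟨hΨ.trans hab.1 hbc.1, fun hac => ?_⟩
    obtain ⟨rfl, rfl⟩ := Prod.mk.inj hac
    exact h.notMem_of_mem hab.1 hbc.1

theorem isNormalizingRoot_opposite (hΨ : IsUnipotentRootSet Ψ) (h : IsSimpleRoot Ψ i j)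
    (total : ∀ k l, k ≠ l → (k, l) ∈ Ψ ∨ (l, k) ∈ Ψ) :
    IsNormalizingRoot j i (Ψ \ {(i, j)}) where
  opposite_notMem h' := h'.2 rfl
  add_left_mem {l} hil := by
    have hlj : j ≠ l := fun hlj => hil.2 (by rw [hlj]; rfl)
    exact ⟨(total j l hlj).resolve_right (h.notMem_of_mem hil.1),
      fun h' => hΨ.ne h.mem (Prod.mk.inj h').1.symm⟩
  add_right_mem {k} hkj := by
    have hki : k ≠ i := fun hki => hkj.2 (by rw [hki]; rfl)
    exact ⟨(total k i hki).resolve_right fun h' => h.notMem_of_mem h' hkj.1,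
      fun h' => hΨ.ne h.mem (Prod.mk.inj h').2⟩

theorem exists_isSimpleRoot (hΨ : IsUnipotentRootSet Ψ) (hne : Ψ.Nonempty) :
    ∃ i j, IsSimpleRoot Ψ i j := by
  obtain ⟨⟨i, l⟩, hil⟩ := hne
  have : IsTrans (Fin n) fun a b => (a, b) ∈ Ψ := ⟨fun _ _ _ => hΨ.trans⟩
  have : Std.Irrefl fun a b : Fin n => (a, b) ∈ Ψ := ⟨hΨ.irrefl⟩
  obtain ⟨j, hij, hmin⟩ := (Finite.wellFounded_of_trans_of_irrefl fun a b => (a, b) ∈ Ψ).has_min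
    {j | (i, j) ∈ Ψ} ⟨l, hil⟩
  exact ⟨i, j, hij, fun {k} => hmin k⟩

theorem eq_one_of_st_eq_one (he : OrthogonalIdempotents e) (hΨ : IsUnipotentRootSet Ψ)
    {x : Steinberg e} (hx : x ∈ rootSubgroup e Ψ) (h : st he x = 1) : x = 1 := by
  induction hm : Ψ.ncard generalizing Ψ x with
  | zero =>
    obtain rfl : Ψ = ∅ := (Set.ncard_eq_zero (Set.toFinite _)).1 hm
    exact rootSubgroup_induction (P := fun x => x = 1) rfl (fun _ _ h => h.elim) hx
  | succ m ih =>
    obtain ⟨i, j, hij⟩ := hΨ.exists_isSimpleRoot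
      (Set.nonempty_of_ncard_ne_zero (by rw [hm]; exact m.succ_ne_zero))
    have hΨ' := hΨ.diff_simpleRoot hij
    rw [← Set.insert_sdiff_self_of_mem hij.mem] at hx
    obtain ⟨p, hp, b, rfl⟩ :=
      (hΨ.isNormalizingRoot_diff hij.mem).exists_mul_steinbergX (hΨ.ne hij.mem) hx
    have hb : b = 0 := by
      have hst : (st he p : R) - 1 = -b := by
        rw [map_mul, mul_eq_one_iff_eq_inv, ← map_inv, ← steinbergX_neg] at h
        rw [h, st_steinbergX_val, AddSubgroup.coe_neg, add_sub_cancel_left]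
      have hentry := idem_mul_st_sub_one_mul_idem he hΨ'.trans hp fun hij' => hij'.2 rfl
      rw [hst, mul_neg, neg_mul, neg_eq_zero, peirce_left he, peirce_right he] at hentry
      exact Subtype.ext hentry
    rw [hb, steinbergX_zero, mul_one] at h ⊢
    exact ih hΨ' hp h (by rw [Set.ncard_sdiff_singleton_of_mem hij.mem, hm, Nat.add_sub_cancel])

end IsUnipotentRootSet

end RootSubgroups

section Levi

variable {R : Type*} [Ring R] {n : ℕ} {e : Fin n → R}

theorem rootSubgroup_prod_compl_sup_eq_top (he : OrthogonalIdempotents e)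
    (hM : ∀ i j, MoritaDominates (e i) (e j)) {s : Set (Fin n)} (hs : s.Nonempty)
    (hs' : sᶜ.Nonempty) : rootSubgroup e (s ×ˢ sᶜ) ⊔ rootSubgroup e (sᶜ ×ˢ s) = ⊤ := by
  have hmem {i j : Fin n} (hij : i ≠ j) (h : i ∈ s ↔ j ∉ s) (a : peirce e i j) :
      steinbergX e hij a ∈ rootSubgroup e (s ×ˢ sᶜ) ⊔ rootSubgroup e (sᶜ ×ˢ s) := by
    by_cases hi : i ∈ s
    · exact Subgroup.mem_sup_left (steinbergX_mem_rootSubgroup hij (Set.mk_mem_prod hi (h.1 hi)) a)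
    · have hj : j ∈ s := by tauto
      exact Subgroup.mem_sup_right (steinbergX_mem_rootSubgroup hij (Set.mk_mem_prod hi hj) a)
  rw [eq_top_iff, ← rootSubgroup_univ, rootSubgroup_le_iff]
  intro i j hij a _
  by_cases h : i ∈ s ↔ j ∈ s
  · obtain ⟨k, hki⟩ : ∃ k, k ∈ s ↔ i ∉ s := by
      by_cases hi : i ∈ s
      · exact hs'.imp fun k hk => iff_of_false hk (not_not.2 hi)
      · exact hs.imp fun k hk => iff_of_true hk hi
    have hik : i ≠ k := by grind
    have hkj : k ≠ j := by grind
    refine steinbergX_mem_of_forall_commutator he (hM k i) hij hik hkj (fun b c => ?_) a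
    exact Subgroup.commutator_le_self _ (Subgroup.commutator_mem_commutator
      (hmem hik (by tauto) b) (hmem hkj (by tauto) c))
  · exact hmem hij (by tauto) a

theorem rootSubgroup_prod_self_le_normalizer {s : Set (Fin n)} {Ψ : Set (Fin n × Fin n)}
    (hΨ : Ψ = s ×ˢ sᶜ ∨ Ψ = sᶜ ×ˢ s) :
    rootSubgroup e (s ×ˢ s) ≤ Subgroup.normalizer (rootSubgroup e Ψ : Set (Steinberg e)) := by
  refine rootSubgroup_le_iff.2 fun {i j} hij a h => ?_
  have hroot : IsNormalizingRoot i j Ψ := by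
    obtain rfl | rfl := hΨ
    · exact ⟨fun h' => h'.2 h.1, fun hl => ⟨h.1, hl.2⟩, fun hk => absurd h.1 hk.2⟩
    · exact ⟨fun h' => h'.1 h.2, fun hl => absurd h.2 hl.1, fun hk => ⟨hk.1, h.2⟩⟩
  exact hroot.steinbergX_mem_normalizer hij a

variable (he : CompleteOrthogonalIdempotents e)

theorem steinbergDiagAct_apply (z : SteinbergDiag he) (y : Steinberg e) :
    steinbergDiagAct he z y = z.left * diagAct he z.right y * z.left⁻¹ :=
  rfl

theorem st_steinbergDiagAct (z : SteinbergDiag he) (y : Steinberg e) :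
    st he.toOrthogonalIdempotents (steinbergDiagAct he z y) =
      steinbergDiagToGL he z * st he.toOrthogonalIdempotents y * (steinbergDiagToGL he z)⁻¹ := by
  have hz : steinbergDiagToGL he z = st he.toOrthogonalIdempotents z.left * (z.right : Rˣ) := rfl
  rw [steinbergDiagAct_apply, hz, map_mul, map_mul, st_diagAct, map_inv]
  group

theorem steinbergDiagAct_apply_eq_self {Ψ : Set (Fin n × Fin n)} (hΨ : IsUnipotentRootSet Ψ)
    {z : SteinbergDiag he} (hz : z ∈ (steinbergDiagToGL he).ker)
    (hn : z.left ∈ Subgroup.normalizer (rootSubgroup e Ψ : Set (Steinberg e)))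
    {y : Steinberg e} (hy : y ∈ rootSubgroup e Ψ) : steinbergDiagAct he z y = y := by
  have hmem : steinbergDiagAct he z y ∈ rootSubgroup e Ψ :=
    (Subgroup.mem_normalizer_iff.1 hn _).1 (diagAct_mem_rootSubgroup he z.right hy)
  refine mul_inv_eq_one.1 (hΨ.eq_one_of_st_eq_one he.toOrthogonalIdempotents
    (mul_mem hmem (inv_mem hy)) ?_)
  rw [map_mul, map_inv, st_steinbergDiagAct, MonoidHom.mem_ker.1 hz]
  group

theorem steinbergDiagAct_eq_one_of_mem_ker (hM : ∀ i j, MoritaDominates (e i) (e j))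
    {s : Set (Fin n)} (hs : s.Nonempty) (hs' : sᶜ.Nonempty) {z : SteinbergDiag he}
    (hz : z ∈ (steinbergDiagToGL he).ker) (hleft : z.left ∈ rootSubgroup e (s ×ˢ s)) :
    steinbergDiagAct he z = 1 := by
  have hfix : ⊤ ≤ (steinbergDiagAct he z).toMonoidHom.eqLocus (MonoidHom.id _) := by
    rw [← rootSubgroup_prod_compl_sup_eq_top he.toOrthogonalIdempotents hM hs hs', sup_le_iff]
    exact ⟨fun y hy => steinbergDiagAct_apply_eq_self he (.prod disjoint_compl_right) hz
        (rootSubgroup_prod_self_le_normalizer (.inl rfl) hleft) hy,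
      fun y hy => steinbergDiagAct_apply_eq_self he (.prod disjoint_compl_left) hz
        (rootSubgroup_prod_self_le_normalizer (.inr rfl) hleft) hy⟩
  exact MulEquiv.ext fun y => hfix (Subgroup.mem_top y)

end Levi

section RankOne

variable {R : Type*} [Ring R] {n : ℕ} {e : Fin n → R} (he : CompleteOrthogonalIdempotents e)

/-- The action of `St(R) ⋊ D(R)` on `St(R)` paired with its map to `GL(R)`. Elements are compared
through this homomorphism because a factorization in `GL(R)` lifts only up to its kernel. -/
def steinbergDiagPair : SteinbergDiag he →* MulAut (Steinberg e) × Rˣ :=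
  (steinbergDiagAct he).prod (steinbergDiagToGL he)

theorem steinbergDiagToGL_inl (x : Steinberg e) :
    steinbergDiagToGL he (.inl x) = st he.toOrthogonalIdempotents x :=
  SemidirectProduct.lift_inl ..

theorem steinbergDiagToGL_inr (d : diagGroup he) : steinbergDiagToGL he (.inr d) = d :=
  SemidirectProduct.lift_inr ..

theorem inr_mul_inl (d : diagGroup he) (x : Steinberg e) :
    (.inr d * .inl x : SteinbergDiag he) = .inl (diagAct he d x) * .inr d := by
  rw [SemidirectProduct.inl_aut, map_inv, inv_mul_cancel_right]

theorem steinbergDiagPair_eq_one_of_mem_ker (hn : 3 ≤ n)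
    (hM : ∀ i j, MoritaDominates (e i) (e j)) {i j : Fin n} {z : SteinbergDiag he}
    (hz : z ∈ (steinbergDiagToGL he).ker) (hleft : z.left ∈ rootSubgroup e ({i, j} ×ˢ {i, j})) :
    steinbergDiagPair he z = 1 := by
  obtain ⟨k, hki, hkj⟩ := Fin.exists_ne_and_ne_of_two_lt i j hn
  have hk : k ∈ ({i, j} : Set (Fin n))ᶜ := fun h => h.elim hki hkj
  exact Prod.ext (steinbergDiagAct_eq_one_of_mem_ker he hM (Set.insert_nonempty i {j}) ⟨k, hk⟩ hz
    hleft) hz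

theorem st_commute_idem_of_mem_rootSubgroup (he : OrthogonalIdempotents e) {s : Set (Fin n)}
    {l : Fin n} (hl : l ∉ s) {w : Steinberg e} (hw : w ∈ rootSubgroup e (s ×ˢ s)) :
    Commute (st he w : R) (e l) := by
  refine rootSubgroup_induction (P := fun w => Commute (st he w : R) (e l)) (by simp) ?_ hw
  intro i j hij a hs y hy
  have hli : e l * e i = 0 := he.ortho fun h => hl (h ▸ hs.1)
  have hjl : e j * e l = 0 := he.ortho fun h => hl (h ▸ hs.2)
  have ha : (st he (steinbergX e hij a) : R) = 1 + e i * a * e j := by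
    rw [st_steinbergX_val, peirce_left he, peirce_right he]
  rw [map_mul, Units.val_mul, ha]
  exact (commute_one_add_mul_mul _ hli hjl).mul_left hy

theorem exists_st_mul_mem_diagGroup (hR : HasStableRankOne R) {i j : Fin n} (hij : i ≠ j)
    {w : Steinberg e} (hw : w ∈ rootSubgroup e ({i, j} ×ˢ {i, j})) :
    ∃ (p : peirce e i j) (q : peirce e j i) (r : peirce e i j), st he.toOrthogonalIdempotents
      (steinbergX e hij.symm q * (steinbergX e hij p * w) * steinbergX e hij r) ∈
        diagGroup he := by
  have he' := he.toOrthogonalIdempotents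
  obtain ⟨p, q, r, hpqr⟩ := HasStableRankOne.exists_commute_forall_notMem he hR
    (g := st he' w) (Finset.notMem_singleton.2 hij) fun l hl =>
      st_commute_idem_of_mem_rootSubgroup he' (s := {i, j}) (by simpa using hl) hw
  rw [Finset.sum_singleton] at hpqr
  refine ⟨peirceProj e i j p, peirceProj e j i q, peirceProj e i j r,
    mem_diagGroup_of_commute he fun l => ?_⟩
  simp only [map_mul, Units.val_mul, st_steinbergX_val, coe_peirceProj]
  obtain rfl | hlj := eq_or_ne l j
  · simpa using commute_sum_of_forall_notMem he hpqr
  · exact hpqr l (Finset.notMem_singleton.2 hlj)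

theorem exists_gauss_rank_one (hR : HasStableRankOne R) (hn : 3 ≤ n)
    (hM : ∀ i j, MoritaDominates (e i) (e j)) {i j : Fin n} (hij : i ≠ j) {w : Steinberg e}
    (hw : w ∈ rootSubgroup e ({i, j} ×ˢ {i, j})) :
    ∃ (p : peirce e i j) (q : peirce e j i) (r : peirce e i j) (d : diagGroup he),
      steinbergDiagPair he (.inl w) = steinbergDiagPair he (.inl (steinbergX e hij p *
        steinbergX e hij.symm q * steinbergX e hij r) * .inr d) := by
  obtain ⟨p, q, r, hd⟩ := exists_st_mul_mem_diagGroup he hR hij hw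
  set y := steinbergX e hij.symm q * (steinbergX e hij p * w) * steinbergX e hij r with hy
  have hmem {k l : Fin n} (hk : k ∈ ({i, j} : Set _)) (hl : l ∈ ({i, j} : Set _)) (hkl : k ≠ l)
      (a : peirce e k l) : steinbergX e hkl a ∈ rootSubgroup e ({i, j} ×ˢ {i, j}) :=
    steinbergX_mem_rootSubgroup hkl (Set.mk_mem_prod hk hl) a
  have hyd : steinbergDiagPair he (.inl y) = steinbergDiagPair he (.inr ⟨_, hd⟩) := by
    rw [← mul_inv_eq_one, ← map_inv, ← map_inv, ← map_mul]
    refine steinbergDiagPair_eq_one_of_mem_ker he hn hM (i := i) (j := j) ?_ ?_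
    · rw [MonoidHom.mem_ker, map_mul, steinbergDiagToGL_inl, steinbergDiagToGL_inr]
      exact mul_inv_cancel _
    · have hyw : y ∈ rootSubgroup e ({i, j} ×ˢ {i, j}) :=
        mul_mem (mul_mem (hmem (by simp) (by simp) _ q)
          (mul_mem (hmem (by simp) (by simp) _ p) hw)) (hmem (by simp) (by simp) _ r)
      simpa using hyw
  have hw' :
      w = steinbergX e hij (-p) * steinbergX e hij.symm (-q) * y * steinbergX e hij (-r) := by
    simp only [hy, steinbergX_neg]
    group
  refine ⟨-p, -q, diagConj he ⟨_, hd⟩ (-r), ⟨_, hd⟩, ?_⟩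
  rw [← diagAct_x, map_mul SemidirectProduct.inl, mul_assoc, ← inr_mul_inl, hw']
  simp only [map_mul, hyd, mul_assoc]

end RankOne

section Gauss

/-- The positive roots, the usual upper triangular ones. -/
def posRoots (n : ℕ) : Set (Fin n × Fin n) := {p | p.1 < p.2}

/-- The negative roots, the usual lower triangular ones. -/
def negRoots (n : ℕ) : Set (Fin n × Fin n) := {p | p.2 < p.1}

theorem isUnipotentRootSet_posRoots (n : ℕ) : IsUnipotentRootSet (posRoots n) :=
  ⟨fun i => lt_irrefl i, fun h h' => lt_trans (α := Fin n) h h'⟩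

theorem isUnipotentRootSet_negRoots (n : ℕ) : IsUnipotentRootSet (negRoots n) :=
  ⟨fun i => lt_irrefl i, fun h h' => lt_trans (α := Fin n) h' h⟩

variable {R : Type*} [Ring R] {n : ℕ} {e : Fin n → R} {i j : Fin n}

theorem isSimpleRoot_posRoots (h : i ⋖ j) : IsSimpleRoot (posRoots n) i j :=
  ⟨h.lt, fun hik hkj => h.2 hik hkj⟩

theorem isSimpleRoot_negRoots (h : j ⋖ i) : IsSimpleRoot (negRoots n) i j :=
  ⟨h.lt, fun hik hkj => h.2 hkj hik⟩

theorem isNormalizingRoot_posRoots_diff (h : j ⋖ i) :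
    IsNormalizingRoot i j (posRoots n \ {(j, i)}) :=
  (isUnipotentRootSet_posRoots n).isNormalizingRoot_opposite (isSimpleRoot_posRoots h)
    fun _ _ => lt_or_gt_of_ne

theorem isNormalizingRoot_negRoots_diff (h : j ⋖ i) :
    IsNormalizingRoot j i (negRoots n \ {(i, j)}) :=
  (isUnipotentRootSet_negRoots n).isNormalizingRoot_opposite (isSimpleRoot_negRoots h)
    fun _ _ => lt_or_gt_of_ne ∘ Ne.symm

theorem steinbergX_mem_of_covBy (he : OrthogonalIdempotents e)
    (hM : ∀ i j, MoritaDominates (e i) (e j)) {H : Subgroup (Steinberg e)}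
    (hH : ∀ {i j : Fin n} (hij : i ≠ j) (a : peirce e i j), j ⋖ i → steinbergX e hij a ∈ H)
    (hij : i ≠ j) (h : j < i) (a : peirce e i j) : steinbergX e hij a ∈ H := by
  induction hm : (i : ℕ) - j using Nat.strong_induction_on generalizing i j with
  | _ m ih =>
    by_cases hcov : j ⋖ i
    · exact hH hij a hcov
    obtain ⟨k, hjk, hki⟩ := exists_lt_lt_of_not_covBy h hcov
    refine steinbergX_mem_of_forall_commutator he (hM k i) hij hki.ne' hjk.ne' (fun b c => ?_) a
    exact Subgroup.commutator_le_self H (Subgroup.commutator_mem_commutator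
      (ih (i - k) (by omega) hki.ne' hki b rfl) (ih (k - j) (by omega) hjk.ne' hjk c rfl))

theorem rootSubgroup_le_stabilizer {Ψ : Set (Fin n × Fin n)} {S : Set (Steinberg e)}
    (hS : ∀ {i j : Fin n} (hij : i ≠ j) (a : peirce e i j), (i, j) ∈ Ψ →
      ∀ y ∈ S, steinbergX e hij a * y ∈ S) :
    rootSubgroup e Ψ ≤ MulAction.stabilizer (Steinberg e) S := by
  refine (MulAction.le_stabilizer_iff_smul_le S _).2 fun g hg => ?_
  rintro _ ⟨y, hy, rfl⟩
  refine rootSubgroup_induction (P := fun g => g * y ∈ S) (by rwa [one_mul]) ?_ hg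
  intro i j hij a hΨ x hx
  rw [mul_assoc]
  exact hS hij a hΨ _ hx

variable (he : CompleteOrthogonalIdempotents e)

/-- The elements of the Steinberg group which have a Gauss decomposition `U⁺ U⁻ U⁺ D` up to the
kernel of `steinbergDiagPair`. -/
def gaussCell : Set (Steinberg e) :=
  {x | ∃ u ∈ rootSubgroup e (posRoots n), ∃ v ∈ rootSubgroup e (negRoots n),
    ∃ u' ∈ rootSubgroup e (posRoots n), ∃ d : diagGroup he,
      steinbergDiagPair he (.inl x) = steinbergDiagPair he (.inl (u * v * u') * .inr d)}

theorem one_mem_gaussCell : 1 ∈ gaussCell he :=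
  ⟨1, one_mem _, 1, one_mem _, 1, one_mem _, 1, by simp only [mul_one, map_one]⟩

theorem steinbergX_mul_mem_gaussCell_of_lt (hij : i ≠ j) (h : i < j) (a : peirce e i j)
    {y : Steinberg e} (hy : y ∈ gaussCell he) : steinbergX e hij a * y ∈ gaussCell he := by
  obtain ⟨u, hu, v, hv, u', hu', d, hd⟩ := hy
  refine ⟨_, mul_mem (steinbergX_mem_rootSubgroup hij h a) hu, v, hv, u', hu', d, ?_⟩
  rw [map_mul SemidirectProduct.inl, map_mul, hd]
  simp only [map_mul, mul_assoc]

theorem exists_gauss_rank_one_mul (hR : HasStableRankOne R) (hn : 3 ≤ n)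
    (hM : ∀ i j, MoritaDominates (e i) (e j)) (h : j ⋖ i) {w q : Steinberg e}
    (hw : w ∈ rootSubgroup e ({j, i} ×ˢ {j, i}))
    (hq : q ∈ rootSubgroup e (negRoots n \ {(i, j)})) :
    ∃ (p r : peirce e j i), ∃ v ∈ rootSubgroup e (negRoots n), ∃ d : diagGroup he,
      steinbergDiagPair he (.inl (w * q)) = steinbergDiagPair he (.inl
        (steinbergX e h.lt.ne p * v * steinbergX e h.lt.ne r) * .inr d) := by
  obtain ⟨p, c, r, d, hd⟩ := exists_gauss_rank_one he hR hn hM h.lt.ne hw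
  have hq' := (isNormalizingRoot_negRoots_diff h).conj_mem h.lt.ne r
    (diagAct_mem_rootSubgroup he d hq)
  refine ⟨p, r, _, mul_mem (steinbergX_mem_rootSubgroup h.lt.ne' h.lt c)
    (rootSubgroup_mono Set.sdiff_subset hq'), d, ?_⟩
  rw [map_mul SemidirectProduct.inl, map_mul, hd, ← map_mul]
  congr 1
  simp only [mul_assoc, inr_mul_inl, MulAut.conj_apply, map_mul, map_inv, inv_mul_cancel_left]

/- The simple roots `±(i, j)` are split off from `U⁺ U⁻` so that they meet the new factor in rank
one; what remains of `U⁺` and `U⁻` is normalized by both of them. -/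
theorem steinbergX_mul_mem_gaussCell_of_covBy (hR : HasStableRankOne R) (hn : 3 ≤ n)
    (hM : ∀ i j, MoritaDominates (e i) (e j)) (hij : i ≠ j) (h : j ⋖ i) (a : peirce e i j)
    {y : Steinberg e} (hy : y ∈ gaussCell he) : steinbergX e hij a * y ∈ gaussCell he := by
  obtain ⟨u, hu, v, hv, u', hu', d, hd⟩ := hy
  have hpos : (j, i) ∈ posRoots n := h.lt
  have hneg : (i, j) ∈ negRoots n := h.lt
  rw [← Set.insert_sdiff_self_of_mem hpos] at hu
  rw [← Set.insert_sdiff_self_of_mem hneg] at hv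
  obtain ⟨p, hp, b, rfl⟩ := ((isUnipotentRootSet_posRoots n).isNormalizingRoot_diff
    hpos).exists_mul_steinbergX hij.symm hu
  obtain ⟨q, hq, c, rfl⟩ := ((isUnipotentRootSet_negRoots n).isNormalizingRoot_diff
    hneg).exists_steinbergX_mul hij hv
  have hmem {k l : Fin n} (hk : k ∈ ({j, i} : Set _)) (hl : l ∈ ({j, i} : Set _)) (hkl : k ≠ l)
      (a : peirce e k l) : steinbergX e hkl a ∈ rootSubgroup e ({j, i} ×ˢ {j, i}) :=
    steinbergX_mem_rootSubgroup hkl (Set.mk_mem_prod hk hl) a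
  obtain ⟨p₀, r₀, v₀, hv₀, d₀, hw⟩ := exists_gauss_rank_one_mul he hR hn hM h
    (mul_mem (mul_mem (hmem (by simp) (by simp) hij a) (hmem (by simp) (by simp) hij.symm b))
      (hmem (by simp) (by simp) hij c)) hq
  have hp' := (isNormalizingRoot_posRoots_diff h).conj_mem hij a hp
  refine ⟨_, mul_mem (rootSubgroup_mono Set.sdiff_subset hp')
      (steinbergX_mem_rootSubgroup hij.symm hpos p₀), v₀, hv₀,
    _, mul_mem (steinbergX_mem_rootSubgroup hij.symm hpos r₀)
      (diagAct_mem_rootSubgroup he d₀ hu'), d₀ * d, ?_⟩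
  rw [map_mul SemidirectProduct.inl, map_mul, hd]
  calc _ = steinbergDiagPair he (.inl (MulAut.conj (steinbergX e hij a) p)) *
        steinbergDiagPair he (.inl (steinbergX e hij a * steinbergX e hij.symm b *
          steinbergX e hij c * q)) * steinbergDiagPair he (.inl u' * .inr d) := by
        simp only [MulAut.conj_apply, map_mul, map_inv]
        group
    _ = _ := by
        rw [hw, ← map_mul, ← map_mul]
        congr 1
        simp only [mul_assoc, map_mul]
        simp only [← mul_assoc, inr_mul_inl]

theorem mem_gaussCell (hR : HasStableRankOne R) (hn : 3 ≤ n)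
    (hM : ∀ i j, MoritaDominates (e i) (e j)) (x : Steinberg e) : x ∈ gaussCell he := by
  have hle : rootSubgroup e {p | p.1 < p.2 ∨ p.2 ⋖ p.1} ≤
      MulAction.stabilizer (Steinberg e) (gaussCell he) :=
    rootSubgroup_le_stabilizer fun hij a h y hy => h.elim
      (fun hlt => steinbergX_mul_mem_gaussCell_of_lt he hij hlt a hy)
      (fun hcov => steinbergX_mul_mem_gaussCell_of_covBy he hR hn hM hij hcov a hy)
  have htop : ⊤ ≤ MulAction.stabilizer (Steinberg e) (gaussCell he) := by
    rw [← rootSubgroup_univ, rootSubgroup_le_iff]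
    intro i j hij a _
    obtain hlt | hgt := lt_or_gt_of_ne hij
    · exact hle (steinbergX_mem_rootSubgroup hij (.inl hlt) a)
    · exact steinbergX_mem_of_covBy he.toOrthogonalIdempotents hM
        (fun hkl b h => hle (steinbergX_mem_rootSubgroup hkl (.inr h) b)) hij hgt a
  have hx := (MulAction.mem_stabilizer_set.1 (htop (Subgroup.mem_top x)) 1).2
    (one_mem_gaussCell he)
  rwa [smul_eq_mul, mul_one] at hx

end Gauss

section Kernel

variable {R : Type*} [Ring R] {n : ℕ} {e : Fin n → R} (he : CompleteOrthogonalIdempotents e)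
include he

theorem idem_mul_mul_mul_idem_eq_zero_of_lt {a b : R}
    (ha : ∀ i j, j < i → e i * a * e j = 0) (hb : ∀ i j, j < i → e i * b * e j = 0)
    {i j : Fin n} (hji : j < i) : e i * (a * b) * e j = 0 := by
  rw [mul_mul_mul_eq_sum he]
  refine Finset.sum_eq_zero fun k _ => ?_
  obtain hki | hik := lt_or_ge k i
  · rw [ha i k hki, zero_mul]
  · rw [hb k j (hji.trans_le hik), mul_zero]

theorem IsUnipotentRootSet.eq_one_of_forall_mem {Ψ : Set (Fin n × Fin n)}
    (hΨ : IsUnipotentRootSet Ψ) {x : Steinberg e} (hx : x ∈ rootSubgroup e Ψ)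
    (h : ∀ i j, (i, j) ∈ Ψ → e i * (st he.toOrthogonalIdempotents x : R) * e j = 0) : x = 1 := by
  refine hΨ.eq_one_of_st_eq_one he.toOrthogonalIdempotents hx
    (Units.ext (ext_peirce he fun i j => ?_))
  by_cases hij : (i, j) ∈ Ψ
  · have hij' : e i * e j = 0 := he.ortho (hΨ.ne hij)
    rw [h i j hij, Units.val_one, mul_one, hij']
  · have hentry := idem_mul_st_sub_one_mul_idem he.toOrthogonalIdempotents hΨ.trans hx hij
    rwa [mul_sub, sub_mul, sub_eq_zero] at hentry

theorem idem_mul_st_mul_idem_eq_zero_of_lt {u : Steinberg e}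
    (hu : u ∈ rootSubgroup e (posRoots n)) (i j : Fin n) (hji : j < i) :
    e i * (st he.toOrthogonalIdempotents u : R) * e j = 0 := by
  have hij : e i * e j = 0 := he.ortho hji.ne'
  have hentry := idem_mul_st_sub_one_mul_idem he.toOrthogonalIdempotents
    (isUnipotentRootSet_posRoots n).trans hu hji.asymm
  rwa [mul_sub, sub_mul, mul_one, hij, sub_zero] at hentry

theorem eq_one_of_st_gauss_eq_one {u v u' : Steinberg e}
    (hu : u ∈ rootSubgroup e (posRoots n)) (hv : v ∈ rootSubgroup e (negRoots n))
    (hu' : u' ∈ rootSubgroup e (posRoots n)) {d : diagGroup he}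
    (h : st he.toOrthogonalIdempotents (u * v * u') * d = 1) : u * v * u' = 1 ∧ d = 1 := by
  have hv1 : v = 1 := by
    refine (isUnipotentRootSet_negRoots n).eq_one_of_forall_mem he hv fun i j hji => ?_
    have hst : st he.toOrthogonalIdempotents v = st he.toOrthogonalIdempotents u⁻¹ *
        (((d⁻¹ : diagGroup he) : Rˣ) * st he.toOrthogonalIdempotents u'⁻¹) := by
      rw [map_mul, map_mul, mul_eq_one_iff_eq_inv] at h
      rw [map_inv, map_inv, Subgroup.coe_inv, ← h]
      group
    rw [hst, Units.val_mul, Units.val_mul]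
    exact idem_mul_mul_mul_idem_eq_zero_of_lt he
      (idem_mul_st_mul_idem_eq_zero_of_lt he (inv_mem hu))
      (fun _ _ => idem_mul_mul_mul_idem_eq_zero_of_lt he (fun _ _ hlt => (d⁻¹).2 _ _ hlt.ne')
        (idem_mul_st_mul_idem_eq_zero_of_lt he (inv_mem hu'))) hji
  subst hv1
  rw [mul_one] at h ⊢
  have huu' : u * u' = 1 := by
    refine (isUnipotentRootSet_posRoots n).eq_one_of_forall_mem he (mul_mem hu hu')
      fun i j hij => ?_
    rw [mul_eq_one_iff_eq_inv.1 h]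
    exact (d⁻¹).2 i j (ne_of_lt hij)
  rw [huu', map_one, one_mul] at h
  exact ⟨huu', Subtype.ext h⟩

theorem ker_steinbergDiagToGL_le (hR : HasStableRankOne R) (hn : 3 ≤ n)
    (hM : ∀ i j, MoritaDominates (e i) (e j)) :
    (steinbergDiagToGL he).ker ≤ (steinbergDiagAct he).ker := by
  rintro ⟨x, g⟩ hx
  obtain ⟨u, hu, v, hv, u', hu', d, hd⟩ := mem_gaussCell he hR hn hM x
  have hz : steinbergDiagPair he ⟨x, g⟩ = steinbergDiagPair he ⟨u * v * u', d * g⟩ := by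
    rw [SemidirectProduct.mk_eq_inl_mul_inr, map_mul, hd, ← map_mul, mul_assoc, ← map_mul,
      ← SemidirectProduct.mk_eq_inl_mul_inr]
  have hst : st he.toOrthogonalIdempotents (u * v * u') * (d * g : diagGroup he) = 1 :=
    (congrArg Prod.snd hz).symm.trans hx
  obtain ⟨huvu', hdg⟩ := eq_one_of_st_gauss_eq_one he hu hv hu' hst
  rw [huvu', hdg] at hz
  exact congrArg Prod.fst (hz.trans (map_one (steinbergDiagPair he)))

end Kernel

section Surjectivity

variable {R : Type*} [Ring R] {n : ℕ} {e : Fin n → R}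

theorem exists_st_eq_one_add_sum_mul_mul_sum (he : OrthogonalIdempotents e) {s t : Finset (Fin n)}
    (hst : Disjoint s t) (r : R) :
    ∃ x : Steinberg e, (st he x : R) = 1 + (∑ i ∈ s, e i) * r * ∑ j ∈ t, e j := by
  suffices h : ∀ P ⊆ s ×ˢ t,
      ∃ x : Steinberg e, (st he x : R) = 1 + ∑ p ∈ P, (peirceProj e p.1 p.2 r : R) by
    obtain ⟨x, hx⟩ := h _ subset_rfl
    refine ⟨x, ?_⟩
    simp only [hx, coe_peirceProj, Finset.sum_product_right, Finset.sum_mul, Finset.mul_sum]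
  intro P hP
  induction P using Finset.induction_on with
  | empty => exact ⟨1, by simp⟩
  | insert p P hp ih =>
    obtain ⟨x, hx⟩ := ih fun q hq => hP (Finset.mem_insert_of_mem hq)
    have hne {q} (hq : q ∈ insert p P) : q.1 ≠ p.2 := fun h =>
      Finset.disjoint_left.1 hst (Finset.mem_product.1 (hP hq)).1
        (h ▸ (Finset.mem_product.1 (hP (Finset.mem_insert_self p P))).2)
    refine ⟨steinbergX e (hne (Finset.mem_insert_self p P)) (peirceProj e p.1 p.2 r) * x, ?_⟩
    have hzero : (peirceProj e p.1 p.2 r : R) * ∑ q ∈ P, (peirceProj e q.1 q.2 r : R) = 0 := by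
      rw [Finset.mul_sum]
      exact Finset.sum_eq_zero fun q hq =>
        peirce_mul_zero he (hne (Finset.mem_insert_of_mem hq)).symm _ _
    rw [map_mul, Units.val_mul, st_steinbergX_val, hx, Finset.sum_insert hp, add_mul, one_mul,
      mul_add, mul_one, hzero]
    abel

variable (he : CompleteOrthogonalIdempotents e)

theorem mem_range_steinbergDiagToGL (hR : HasStableRankOne R) (s : Finset (Fin n)) {g : Rˣ}
    (hg : ∀ l ∉ s, Commute (g : R) (e l)) : g ∈ (steinbergDiagToGL he).range := by
  have he' := he.toOrthogonalIdempotents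
  induction s using Finset.induction_on generalizing g with
  | empty =>
    exact ⟨.inr ⟨g, mem_diagGroup_of_commute he fun l => hg l (Finset.notMem_empty l)⟩,
      steinbergDiagToGL_inr ..⟩
  | insert i t hi ih =>
    obtain ⟨p, q, r, hpqr⟩ := HasStableRankOne.exists_commute_forall_notMem he hR hi hg
    have hst := Finset.disjoint_singleton_left.2 hi
    obtain ⟨x, hx⟩ := exists_st_eq_one_add_sum_mul_mul_sum he' hst p
    obtain ⟨y, hy⟩ := exists_st_eq_one_add_sum_mul_mul_sum he' hst.symm q
    obtain ⟨z, hz⟩ := exists_st_eq_one_add_sum_mul_mul_sum he' hst r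
    rw [Finset.sum_singleton] at hx hy hz
    have hrange (w : Steinberg e) : st he' w ∈ (steinbergDiagToGL he).range :=
      ⟨.inl w, steinbergDiagToGL_inl he w⟩
    have hmem : st he' y * (st he' x * g) * st he' z ∈ (steinbergDiagToGL he).range :=
      ih fun l hl => by simpa only [Units.val_mul, hx, hy, hz] using hpqr l hl
    rwa [Subgroup.mul_mem_cancel_right _ (hrange z), Subgroup.mul_mem_cancel_left _ (hrange y),
      Subgroup.mul_mem_cancel_left _ (hrange x)] at hmem

theorem steinbergDiagToGL_surjective (hR : HasStableRankOne R) :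
    Function.Surjective (steinbergDiagToGL he) := fun _ =>
  mem_range_steinbergDiagToGL he hR Finset.univ fun l hl => absurd (Finset.mem_univ l) hl

end Surjectivity

section CrossedModule

variable {G H K : Type*} [Group G] [Group H] [Group K]

theorem commutatorElement_mul_mul_of_mem_center {z t : G} (hz : z ∈ Subgroup.center G)
    (ht : t ∈ Subgroup.center G) (x y : G) : ⁅z * x, t * y⁆ = ⁅x, y⁆ := by
  have hz' := Subgroup.mem_center_iff.1 hz
  have ht' := Subgroup.mem_center_iff.1 ht
  rw [commutatorElement_mul_left_eq_conj_mul, commutatorElement_mul_right_eq_mul_conj,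
    commutatorElement_eq_one_iff_mul_comm.2 (ht' x), one_mul,
    commutatorElement_eq_one_iff_mul_comm.2 (hz' (t * y)).symm, mul_one,
    ← ht', mul_inv_cancel_right, ← hz', mul_inv_cancel_right]

theorem monoidHom_ext_of_isPerfect [Group.IsPerfect G] {f g : G →* H}
    (h : ∀ x, f x * (g x)⁻¹ ∈ Subgroup.center H) : f = g := by
  have hle : commutator G ≤ f.eqLocus g := by
    refine Subgroup.commutator_le.2 fun x _ y _ => ?_
    have hfg (w : G) : f w = f w * (g w)⁻¹ * g w := (inv_mul_cancel_right _ _).symm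
    change f ⁅x, y⁆ = g ⁅x, y⁆
    rw [map_commutatorElement, map_commutatorElement, hfg x, hfg y,
      commutatorElement_mul_mul_of_mem_center (h x) (h y)]
  rw [Group.isPerfect_def.1 ‹_›] at hle
  exact MonoidHom.eq_of_eqOn_top hle

theorem IsCrossedModule.ker_le_center {d : H →* G} {φ : G →* MulAut H}
    (h : IsCrossedModule d φ) : d.ker ≤ Subgroup.center H := by
  intro x hx
  refine Subgroup.mem_center_iff.2 fun y => ?_
  have hxy := h.peiffer x y
  rwa [hx, map_one, MulAut.one_apply, eq_mul_inv_iff_mul_eq] at hxy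

theorem IsCrossedModule.comp_eq_of_equivariant [Group.IsPerfect H] {d : H →* G}
    {φ : G →* MulAut H} (hφ : IsCrossedModule d φ) {p : K →* G} {α : K →* MulAut H}
    (hα : ∀ k y, d (α k y) = p k * d y * (p k)⁻¹) : φ.comp p = α := by
  refine MonoidHom.ext fun k => MulEquiv.ext fun y => ?_
  suffices h : (φ (p k)).toMonoidHom = (α k).toMonoidHom from DFunLike.congr_fun h y
  refine monoidHom_ext_of_isPerfect fun x => hφ.ker_le_center ?_
  change d (φ (p k) x * (α k x)⁻¹) = 1
  rw [map_mul, map_inv, hφ.equivariant, hα, mul_inv_cancel]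

theorem IsCrossedModule.unique [Group.IsPerfect H] {d : H →* G} {φ ψ : G →* MulAut H}
    (hφ : IsCrossedModule d φ) (hψ : IsCrossedModule d ψ) : φ = ψ :=
  hφ.comp_eq_of_equivariant (p := MonoidHom.id G) hψ.equivariant

theorem exists_isCrossedModule_of_surjective {d : H →* G} {p : K →* G} {α : K →* MulAut H}
    (hp : Function.Surjective p) (hker : p.ker ≤ α.ker)
    (hα : ∀ k y, d (α k y) = p k * d y * (p k)⁻¹) {ι : H →* K} (hpι : p.comp ι = d)
    (hαι : α.comp ι = MulAut.conj) : ∃ φ : G →* MulAut H, IsCrossedModule d φ := by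
  let φ := p.liftOfSurjective hp ⟨α, hker⟩
  have hφ (k : K) : φ (p k) = α k := p.liftOfRightInverse_comp_apply _ _ _ k
  refine ⟨φ, ⟨fun g y => ?_⟩, fun x y => ?_⟩
  · obtain ⟨k, rfl⟩ := hp g
    rw [hφ, hα]
  · rw [← hpι, MonoidHom.comp_apply, hφ, ← MonoidHom.comp_apply, hαι, MulAut.conj_apply]

end CrossedModule

end IsotropicGL

theorem mainTheorem2_general {R : Type*} [Ring R] (hR : IsotropicGL.HasStableRankOne R)
    {n : ℕ} (hn : 3 ≤ n) (e : Fin n → R) (he : CompleteOrthogonalIdempotents e)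
    (hM : ∀ i j : Fin n, IsotropicGL.MoritaEquivalent (e i) (e j)) :
    (∃! φ : Rˣ →* MulAut (IsotropicGL.Steinberg e),
      IsotropicGL.IsCrossedModule (IsotropicGL.st he.toOrthogonalIdempotents) φ) ∧
    (∀ φ : Rˣ →* MulAut (IsotropicGL.Steinberg e),
      IsotropicGL.IsCrossedModule (IsotropicGL.st he.toOrthogonalIdempotents) φ →
        φ.comp (IsotropicGL.steinbergDiagToGL he) = IsotropicGL.steinbergDiagAct he) := by
  have hM' : ∀ i j, IsotropicGL.MoritaDominates (e i) (e j) := fun i j => (hM i j).1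
  have := IsotropicGL.isPerfect_steinberg hn he.toOrthogonalIdempotents hM'
  obtain ⟨φ, hφ⟩ := IsotropicGL.exists_isCrossedModule_of_surjective
    (IsotropicGL.steinbergDiagToGL_surjective he hR)
    (IsotropicGL.ker_steinbergDiagToGL_le he hR hn hM')
    (IsotropicGL.st_steinbergDiagAct he)
    (ι := SemidirectProduct.inl)
    (SemidirectProduct.lift_comp_inl ..) (SemidirectProduct.lift_comp_inl ..)
  exact ⟨⟨φ, hφ, fun ψ hψ => hψ.unique hφ⟩,
    fun ψ hψ => hψ.comp_eq_of_equivariant (IsotropicGL.st_steinbergDiagAct he)⟩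

theorem mainTheorem2 {R : Type*} [Ring R] (hR : IsotropicGL.IsSemiLocalRing R)
    {n : ℕ} (hn : 3 ≤ n) (e : Fin n → R) (he : CompleteOrthogonalIdempotents e)
    (hM : ∀ i j : Fin n, IsotropicGL.MoritaEquivalent (e i) (e j)) :
    (∃! φ : Rˣ →* MulAut (IsotropicGL.Steinberg e),
      IsotropicGL.IsCrossedModule (IsotropicGL.st he.toOrthogonalIdempotents) φ) ∧
    (∀ φ : Rˣ →* MulAut (IsotropicGL.Steinberg e),
      IsotropicGL.IsCrossedModule (IsotropicGL.st he.toOrthogonalIdempotents) φ →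
        φ.comp (IsotropicGL.steinbergDiagToGL he) = IsotropicGL.steinbergDiagAct he) :=
  mainTheorem2_general hR.hasStableRankOne hn e he hM
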